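/- Let $d\in\mathbb N$ and let $\mathbb T^d=\mathbb R^d/2\pi\mathbb Z^d$ be the flat torus with distance $\mathrm{dist}(x,y)=\min_{k\in\mathbb Z^d}\|x-y-2\pi k\|$ and Lebesgue measure. For $\varepsilon>0$ put $\mathcal K_\varepsilon(x)=(2\pi\varepsilon)^{-d/2}\sum_{k\in\mathbb Z^d}e^{-\|x-2\pi k\|^2/(2\varepsilon)}$ and $c_\varepsilon(x,y)=-\varepsilon\log\mathcal K_\varepsilon(x-y)$. For a probability measure $\rho$ on $\mathbb T^d$ put $$\mathcal T_\rho^\varepsilon[f](z)=-\varepsilon\log\int_{\mathbb T^d} e^{(f(w)-c_\varepsilon(w,z))/\varepsilon}\,d\rho(w),$$ and for probability measures $\mu,\nu$ put $$\mathcal I^\varepsilon_{\mu,\nu}[\phi]=\int\phi\,d\mu+\int\mathcal T^\varepsilon_\mu[\phi]\,d\nu,\qquad \overline{\mathcal I}^\varepsilon_{\mu,\nu}[\psi]=\int\mathcal T^\varepsilon_\nu[\psi]\,d\mu+\int\psi\,d\nu .$$ Schrödinger potentials for $(\mu,\nu,\varepsilon)$ are a pair $(\phi_\varepsilon,\psi_\varepsilon)\in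 L^1(\mu)\times L^1(\nu)$ that maximizes $$(\phi,\psi)\mapsto\int\phi\,d\mu+\int\psi\,d\nu-\varepsilon\iint e^{(\phi(x)+\psi(y)-c_\varepsilon(x,y))/\varepsilon}\,d\mu(x)\,d\nu(y)+\varepsilon$$ over $L^1(\mu)\times L^1(\nu)$ (the value is $-\infty$ where the double integral diverges). Write $\mathbb V_\mu(f)=\int(f-\int f\,d\mu)^2\,d\mu$ and $\mathrm{osc}(f)=\sup f-\inf f$. Call a pair $\alpha,R>0$ admissible in dimension $d$ if $f(x)=\mathrm{dist}(0,x)^2$ is $\alpha$-strongly convex on the ball $B=\{x\in\mathbb T^d:\mathrm{dist}(0,x)<R\}$, that is, $$f(z)\le(1-t)f(x_0)+tf(x_1)-\tfrac{\alpha t(1-t)}2\,\mathrm{dist}(x_0,x_1)^2$$ for all $t\in[0,1]$, $x_0,x_1\in B$ and all $z\in B$ with $\mathrm{dist}(z,x_0)=t\,\mathrm{dist}(x_0,x_1)$ and $\mathrm{dist}(z,x_1)=(1-t)\,\mathrm{dist}(x_0,x_1)$. **Theorem (stability of the Schrödinger functional).** There is a pair $\alpha,R>0$ that is admissible in every dimension.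 Moreover, for every $d$ there is a function $C$, assigning to positive reals $m,M$ a positive real $C(m,M)$, such that the following holds for every pair $\alpha,R>0$ admissible in dimension $d$. Let $m_\mu,M_\mu,m_\nu,M_\nu>0$, let $\mu,\nu$ be probability densities on $\mathbb T^d$ with $m_\mu\le\mu(x)\le M_\mu$ and $m_\nu\le\nu(x)\le M_\nu$ for all $x$, let $\varepsilon>0$, and let $(\phi_\varepsilon,\psi_\varepsilon)$ be Schrödinger potentials. Then, with $C_\nu=C(m_\nu,M_\nu)$ and $C_\mu=C(m_\mu,M_\mu)$, for all continuous $\chi,\eta:\mathbb T^d\to\mathbb R$, $$\mathbb V_\mu(\chi)\le\Big(4\varepsilon+C_\nu e^{\frac{2R^2}{\alpha}+8\pi^2d}+\frac{8\,\mathrm{osc}(\chi)^2}{3\varepsilon}\Big)\Big[\mathcal I^\varepsilon_{\mu,\nu}[\phi_\varepsilon]-\mathcal I^\varepsilon_{\mu,\nu}[\phi_\varepsilon+\chi]\Big],$$ $$\mathbb V_\nu(\eta)\le\Big(4\varepsilon+C_\mu e^{\frac{2R^2}{\alpha}+8\pi^2d}+\frac{8\,\mathrm{osc}(\eta)^2}{3\varepsilon}\Big)\Big[\overline{\mathcal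 I}^\varepsilon_{\mu,\nu}[\psi_\varepsilon]-\overline{\mathcal I}^\varepsilon_{\mu,\nu}[\psi_\varepsilon+\eta]\Big].$$ -/

import Mathlib

open Real MeasureTheory ProbabilityTheory

noncomputable section

namespace SchrodingerStability

/-- The positivity of the period, needed for the measure on the circle `ℝ / 2πℤ`. -/
instance fact_two_pi_pos : Fact (0 < 2 * π) := ⟨Real.two_pi_pos⟩

/-- The flat torus `ℝ^d / 2πℤ^d`, with its product topology; `volume` is the Lebesgue measure, of
total mass `(2π)^d`. (The sup-distance that the function type carries is not used.) -/
abbrev Torus (d : ℕ) : Type := Fin d → AddCircle (2 * π)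

/-- The representative of a point of the torus in `[0, 2π)^d`. -/
def rep {d : ℕ} (x : Torus d) (i : Fin d) : ℝ := (AddCircle.equivIco (2 * π) 0 (x i) : ℝ)

/-- The Euclidean norm `‖x - 2πk‖` of a translate of the vector `x`. -/
def shiftNorm {d : ℕ} (x : Fin d → ℝ) (k : Fin d → ℤ) : ℝ :=
  ‖(WithLp.toLp 2 (fun i => x i - 2 * π * (k i : ℝ)) : EuclideanSpace ℝ (Fin d))‖

/-- The flat distance `min_k ‖x - y - 2πk‖`. -/
def torusDist {d : ℕ} (x y : Torus d) : ℝ :=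
  ⨅ k : Fin d → ℤ, shiftNorm (fun i => rep x i - rep y i) k

/-- The open ball of the flat distance. -/
def torusBall {d : ℕ} (x : Torus d) (r : ℝ) : Set (Torus d) := {y | torusDist x y < r}

/-- The heat kernel `K_ε(x) = (2πε)^(-d/2) ∑_k exp(-‖x - 2πk‖² / (2ε))`. -/
def gaussKernel {d : ℕ} (ε : ℝ) (x : Torus d) : ℝ :=
  1 / √((2 * π * ε) ^ d) * ∑' k : Fin d → ℤ, Real.exp (-(shiftNorm (rep x) k) ^ 2 / (2 * ε))

/-- The cost `c_ε(x, y) = -ε log K_ε(x - y)`, symmetric in `x` and `y`. -/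
def cost {d : ℕ} (ε : ℝ) (x y : Torus d) : ℝ := -ε * Real.log (gaussKernel ε (x - y))

/-- `ρ` is a probability density function on the torus with values in `[m, M]`. -/
structure IsDensityIn {d : ℕ} (m M : ℝ) (ρ : Torus d → ℝ) : Prop where
  measurable : Measurable ρ
  mem_Icc : ∀ x, ρ x ∈ Set.Icc m M
  integral_eq_one : ∫ x, ρ x = 1

/-- The measure `ρ(x) dx`. -/
def densityMeasure {d : ℕ} (ρ : Torus d → ℝ) : Measure (Torus d) :=
  volume.withDensity (fun x => ENNReal.ofReal (ρ x))

/-- `T_ρ^ε[f](z) = -ε log ∫ exp((f(w) - c_ε(w, z)) / ε) dρ(w)`. As `c_ε` is symmetric, this is the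
transform in either of the two marginals. -/
def transform {d : ℕ} (ε : ℝ) (ρ : Measure (Torus d)) (f : Torus d → ℝ) (z : Torus d) : ℝ :=
  -ε * Real.log (∫ w, Real.exp ((f w - cost ε w z) / ε) ∂ρ)

/-- The Schrödinger functional `I[φ] = ∫ φ dμ + ∫ T_μ[φ] dν`. -/
def schrodingerFunctional {d : ℕ} (ε : ℝ) (μ ν : Measure (Torus d)) (φ : Torus d → ℝ) : ℝ :=
  ∫ x, φ x ∂μ + ∫ y, transform ε μ φ y ∂ν

/-- The dual Schrödinger functional `Ī[ψ] = ∫ T_ν[ψ] dμ + ∫ ψ dν`. -/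
def schrodingerFunctionalBar {d : ℕ} (ε : ℝ) (μ ν : Measure (Torus d)) (ψ : Torus d → ℝ) : ℝ :=
  ∫ x, transform ε ν ψ x ∂μ + ∫ y, ψ y ∂ν

/-- The density `exp((φ(x) + ψ(y) - c_ε(x, y)) / ε)` with respect to `μ ⊗ ν`. -/
def gibbsDensity {d : ℕ} (ε : ℝ) (φ ψ : Torus d → ℝ) (p : Torus d × Torus d) : ℝ :=
  Real.exp ((φ p.1 + ψ p.2 - cost ε p.1 p.2) / ε)

/-- The pairs in `L¹(μ) × L¹(ν)` at which the dual objective of entropic optimal transport is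
finite; at all other pairs in `L¹(μ) × L¹(ν)` its value is `-∞`. -/
structure DualFinite {d : ℕ} (ε : ℝ) (μ ν : Measure (Torus d)) (φ ψ : Torus d → ℝ) : Prop where
  integrable_left : Integrable φ μ
  integrable_right : Integrable ψ ν
  integrable_gibbs : Integrable (gibbsDensity ε φ ψ) (μ.prod ν)

/-- The dual objective
`∫ φ dμ + ∫ ψ dν - ε ∬ exp((φ(x) + ψ(y) - c_ε(x, y)) / ε) dμ(x) dν(y) + ε`. -/
def dualObjective {d : ℕ} (ε : ℝ) (μ ν : Measure (Torus d)) (φ ψ : Torus d → ℝ) : ℝ :=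
  ∫ x, φ x ∂μ + ∫ y, ψ y ∂ν - ε * ∫ p, gibbsDensity ε φ ψ p ∂(μ.prod ν) + ε

/-- `(φ, ψ)` are Schrödinger potentials: they maximize the dual objective of entropic optimal
transport over `L¹(μ) × L¹(ν)`. -/
structure IsSchrodingerPotentials {d : ℕ} (ε : ℝ) (μ ν : Measure (Torus d))
    (φ ψ : Torus d → ℝ) : Prop where
  finite : DualFinite ε μ ν φ ψ
  isMax : ∀ φ' ψ' : Torus d → ℝ, DualFinite ε μ ν φ' ψ' →
    dualObjective ε μ ν φ' ψ' ≤ dualObjective ε μ ν φ ψ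

/-- The oscillation `sup χ - inf χ`. -/
def osc {d : ℕ} (χ : C(Torus d, ℝ)) : ℝ := (⨆ x, χ x) - ⨅ x, χ x

/-- The geodesic interpolants in `S` at time `t` between `x₀` and `x₁`. -/
def geodesicPoints {d : ℕ} (S : Set (Torus d)) (t : ℝ) (x₀ x₁ : Torus d) : Set (Torus d) :=
  {z | z ∈ S ∧ torusDist z x₀ = t * torusDist x₀ x₁ ∧ torusDist z x₁ = (1 - t) * torusDist x₀ x₁}

/-- `α`-strong convexity of `f` along geodesics in `S`. -/
def IsStronglyConvexOn {d : ℕ} (α : ℝ) (S : Set (Torus d)) (f : Torus d → ℝ) : Prop :=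
  ∀ t ∈ Set.Icc (0 : ℝ) 1, ∀ x₀ ∈ S, ∀ x₁ ∈ S, ∀ z ∈ geodesicPoints S t x₀ x₁,
    f z ≤ (1 - t) * f x₀ + t * f x₁ - α * t * (1 - t) / 2 * torusDist x₀ x₁ ^ 2

/-- On the ball of radius `R` around the origin of the `d`-dimensional torus, the squared distance
to the origin is `α`-strongly convex. -/
def SqDistStronglyConvex (d : ℕ) (α R : ℝ) : Prop :=
  IsStronglyConvexOn α (torusBall (0 : Torus d) R) (fun x => torusDist (0 : Torus d) x ^ 2)

end SchrodingerStability

end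

noncomputable section

namespace SchrodingerStability

/-! ### The parametrized form of the Cauchy-Schwarz inequality -/

/-! Put `X = χ/ε`, let `ρ = exp(φ/ε) μ`, and let `Λ(t)` be the `ν`-average of `log ∫ exp(tX) K_ε(· -
y) dρ`. Then `I[φ + εtX]` is `∫ φ dμ + εt ∫ X dμ - εΛ(t)`. Optimality of the potentials gives `Λ'(0)
= ∫ X dμ`, so the deficit `I[φ] - I[φ + χ]` is `ε(Λ(1) - Λ(0) - Λ'(0))`, a convexity remainder. The
task is to bound `Var_μ(X)` by this remainder.

`Λ''(t)` is the average over `y` of the conditional variances of `X` under the tilted kernel. By the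
law of total variance, `Var_μ(X)` is `Λ''(0)` plus the `ν`-variance of the conditional means. The
latter is controlled by a Poincaré-type inequality (`variance_tiltMean_le`). The function `K_ε(w -
z) exp(‖z‖²/(2ε))` is a sum of exponentials of affine functions of `z`, hence log-convex. So
`M(t,z)^(-ε) exp(-‖z‖²/2)`, with `M` the tilted mass, is log-concave jointly in `(t,z)`. By
Prékopa-Leindler (`prekopa_cube`) its integral over a period cube is log-concave in `t`. The
second-derivative form of this statement is a variance bound of Brascamp-Lieb type
(`variance_tiltMean_cube_le`). On the cube the weight is comparable to a constant, up to a factor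
free of `ε`, and so is the density of `ν`.

The remainder involves `Λ''` on all of `[0,1]`, not only at `0`. A Chebyshev correlation inequality
(`tiltSecond_add_mono`) compares second moments at times `0` and `t` at the cost of a multiple of
`osc(X)(Λ'(t) - Λ'(0))`. Integrating twice (`le_of_differential_inequality`) gives the estimate. The
second inequality is the first with the marginals exchanged. -/

lemma sq_le_mul_of_forall_two_mul_le {m A B : ℝ} (hA : 0 < A) (hB : 0 < B) (hm : 0 ≤ m)
    (h : ∀ l : ℝ, 0 < l → 2 * m ≤ l * A + l⁻¹ * B) : m ^ 2 ≤ A * B := by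
  -- This `l` minimizes `l * A + l⁻¹ * B`.
  have hl := h (√B / √A) (by positivity)
  have h1 : √B / √A * A + (√B / √A)⁻¹ * B = 2 * (√A * √B) := by
    have ha : √A ≠ 0 := by positivity
    have hb : √B ≠ 0 := by positivity
    have e1 : √A ^ 2 = A := Real.sq_sqrt hA.le
    have e2 : √B ^ 2 = B := Real.sq_sqrt hB.le
    field_simp
    rw [e1, e2]; ring
  rw [h1] at hl
  have h2 : m ≤ √A * √B := by linarith
  calc m ^ 2 ≤ (√A * √B) ^ 2 := by gcongr
    _ = A * B := by rw [mul_pow, Real.sq_sqrt hA.le, Real.sq_sqrt hB.le]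

/-- Together with the preceding converse this carries a bound `m² ≤ ab` through sums and integrals:
linearize pointwise, add up, then optimize over `l`. -/
lemma two_mul_le_of_sq_le_mul {m a b l : ℝ} (ha : 0 ≤ a) (hb : 0 ≤ b) (hl : 0 < l)
    (h : m ^ 2 ≤ a * b) : 2 * m ≤ l * a + l⁻¹ * b := by
  refine le_of_abs_le (abs_le_of_sq_le_sq ?_ (by positivity))
  have : l * l⁻¹ = 1 := mul_inv_cancel₀ hl.ne'
  have h3 : (l * a) * (l⁻¹ * b) = a * b := by
    calc _ = (l * l⁻¹) * (a * b) := by ring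
      _ = _ := by rw [this, one_mul]
  nlinarith [sq_nonneg (l * a - l⁻¹ * b)]

/-! ### The theta function -/

/-- The periodized Gaussian `∑_k exp(-(x - 2πk)² / (2ε))`. -/
def theta (ε x : ℝ) : ℝ := ∑' k : ℤ, Real.exp (-(x - 2 * π * k) ^ 2 / (2 * ε))

lemma summable_exp_neg_mul_sq_int {c : ℝ} (hc : 0 < c) :
    Summable fun k : ℤ => Real.exp (-(c * (k : ℝ) ^ 2)) := by
  have hn : Summable fun n : ℕ => Real.exp (-(c * (n : ℝ) ^ 2)) := by
    simpa using Real.summable_exp_nat_mul_of_ge (neg_lt_zero.2 hc)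
      (f := fun n => (n : ℝ) ^ 2) fun n => by exact_mod_cast Nat.le_self_pow two_ne_zero n
  exact Summable.of_nat_of_neg (by simpa using hn) (by simpa using hn)

/-- A summable majorant uniform for `|x| ≤ R`. It comes from `(x - 2πk)² + x² - 2π²k² = 2(x - πk)² ≥
0`. -/
lemma gauss_term_le {ε R x : ℝ} (hε : 0 < ε) (hx : |x| ≤ R) (k : ℤ) :
    Real.exp (-(x - 2 * π * k) ^ 2 / (2 * ε)) ≤
      Real.exp (R ^ 2 / (2 * ε)) * Real.exp (-(π ^ 2 / ε * (k : ℝ) ^ 2)) := by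
  rw [← Real.exp_add]
  refine Real.exp_le_exp.2 ?_
  have h1 : x ^ 2 ≤ R ^ 2 := sq_le_sq.2 (hx.trans (le_abs_self R))
  have h2 : R ^ 2 / (2 * ε) + -(π ^ 2 / ε * (k : ℝ) ^ 2)
      = (R ^ 2 - 2 * π ^ 2 * (k : ℝ) ^ 2) / (2 * ε) := by
    field_simp; ring
  rw [h2]
  gcongr
  nlinarith [sq_nonneg (x - π * k)]

lemma summable_theta {ε : ℝ} (hε : 0 < ε) (x : ℝ) :
    Summable fun k : ℤ => Real.exp (-(x - 2 * π * k) ^ 2 / (2 * ε)) :=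
  Summable.of_nonneg_of_le (fun _ => (Real.exp_pos _).le) (gauss_term_le hε le_rfl)
    ((summable_exp_neg_mul_sq_int (by positivity)).mul_left _)

lemma theta_pos {ε : ℝ} (hε : 0 < ε) (x : ℝ) : 0 < theta ε x :=
  (summable_theta hε x).tsum_pos (fun _ => (Real.exp_pos _).le) 0 (Real.exp_pos _)

lemma theta_periodic (ε : ℝ) : Function.Periodic (theta ε) (2 * π) := by
  intro x
  unfold theta
  rw [← (Equiv.addRight (1 : ℤ)).tsum_eq]
  congr 1; ext k
  simp only [Equiv.coe_addRight]
  push_cast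
  ring_nf

lemma theta_neg (ε x : ℝ) : theta ε (-x) = theta ε x := by
  unfold theta
  rw [← (Equiv.neg ℤ).tsum_eq]
  congr 1; ext k
  simp only [Equiv.neg_apply]
  push_cast
  ring_nf

lemma continuous_theta {ε : ℝ} (hε : 0 < ε) : Continuous (theta ε) := by
  rw [continuous_iff_continuousAt]
  intro x
  have h : ContinuousOn (theta ε) (Metric.ball 0 (|x| + 1)) := by
    refine continuousOn_tsum (fun k => by fun_prop)
      ((summable_exp_neg_mul_sq_int (c := π ^ 2 / ε) (by positivity)).mul_left
        (Real.exp ((|x| + 1) ^ 2 / (2 * ε)))) (fun k y hy => ?_)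
    rw [Real.norm_of_nonneg (Real.exp_pos _).le]
    refine gauss_term_le hε ?_ k
    simpa using (mem_ball_zero_iff.1 hy).le
  exact h.continuousAt (Metric.isOpen_ball.mem_nhds (by simp))

/-- The quadratic terms in `a` cancel in `-(w - a - 2πk)² + a²`, so each summand is the exponential
of an affine function of `a` and satisfies the midpoint relation with equality. Summation preserves
log-convexity. -/
lemma theta_midpoint {ε : ℝ} (hε : 0 < ε) (w a b : ℝ) :
    (theta ε (w - (a + b) / 2) * Real.exp (((a + b) / 2) ^ 2 / (2 * ε))) ^ 2 ≤
      (theta ε (w - a) * Real.exp (a ^ 2 / (2 * ε))) *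
        (theta ε (w - b) * Real.exp (b ^ 2 / (2 * ε))) := by
  have hp := theta_pos hε
  refine sq_le_mul_of_forall_two_mul_le (by have := hp (w - a); positivity)
    (by have := hp (w - b); positivity) (by have := hp (w - (a + b) / 2); positivity)
    fun l hl => ?_
  simp only [theta, ← tsum_mul_right, ← tsum_mul_left]
  rw [← Summable.tsum_add]
  · refine Summable.tsum_le_tsum (fun k => ?_) ?_ ?_
    · refine two_mul_le_of_sq_le_mul (by positivity) (by positivity) hl (le_of_eq ?_)
      rw [← Real.exp_add, ← Real.exp_add, ← Real.exp_add, ← Real.exp_add, sq, ← Real.exp_add]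
      congr 1
      field_simp
      ring
    · exact ((summable_theta hε _).mul_right _).mul_left _
    · exact (((summable_theta hε _).mul_right _).mul_left _).add
        (((summable_theta hε _).mul_right _).mul_left _)
  · exact ((summable_theta hε _).mul_right _).mul_left _
  · exact ((summable_theta hε _).mul_right _).mul_left _

/-- A Harnack inequality. By periodicity `x` may be taken in `[y, y + 2π)`, say `x = y + 2πt`.
Interpolating the square between `y` and `y + 2π` leaves the error `4π²t(1 - t) ≤ π²`. Convexity of
`exp` then bounds each term, and both endpoints have the same theta value. -/
lemma theta_le_mul_theta {ε : ℝ} (hε : 0 < ε) (x y : ℝ) :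
    theta ε x ≤ Real.exp (π ^ 2 / (2 * ε)) * theta ε y := by
  obtain ⟨x', hx', hxx⟩ := (theta_periodic ε).exists_mem_Ico Real.two_pi_pos x y
  rw [hxx]
  set t : ℝ := (x' - y) / (2 * π) with ht
  have ht0 : 0 ≤ t := div_nonneg (by linarith [hx'.1]) Real.two_pi_pos.le
  have ht1 : t ≤ 1 := by
    rw [ht, div_le_one Real.two_pi_pos]; linarith [hx'.2]
  have hx : x' = y + t * (2 * π) := by
    rw [ht]; field_simp; ring
  have key : ∀ k : ℤ, Real.exp (-(x' - 2 * π * k) ^ 2 / (2 * ε)) ≤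
      Real.exp (π ^ 2 / (2 * ε)) * ((1 - t) * Real.exp (-(y - 2 * π * k) ^ 2 / (2 * ε))
        + t * Real.exp (-(y + 2 * π - 2 * π * k) ^ 2 / (2 * ε))) := by
    intro k
    have hc := convexOn_exp.2 (Set.mem_univ (-(y - 2 * π * k) ^ 2 / (2 * ε)))
      (Set.mem_univ (-(y + 2 * π - 2 * π * k) ^ 2 / (2 * ε))) (by linarith : 0 ≤ 1 - t) ht0
      (by ring)
    simp only [smul_eq_mul] at hc
    refine le_trans ?_ (mul_le_mul_of_nonneg_left hc (Real.exp_pos _).le)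
    rw [← Real.exp_add]
    refine Real.exp_le_exp.2 ?_
    have e : π ^ 2 / (2 * ε) + ((1 - t) * (-(y - 2 * π * k) ^ 2 / (2 * ε))
        + t * (-(y + 2 * π - 2 * π * k) ^ 2 / (2 * ε)))
        = (π ^ 2 - (1 - t) * (y - 2 * π * k) ^ 2 - t * (y + 2 * π - 2 * π * k) ^ 2) / (2 * ε) := by
      ring
    rw [e, hx]
    gcongr
    nlinarith [mul_nonneg (sq_nonneg π) (sq_nonneg (2 * t - 1))]
  have s1 := summable_theta hε y
  have s2 := summable_theta hε (y + 2 * π)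
  have hs := ((s1.mul_left (1 - t)).add (s2.mul_left t))
  calc theta ε x' ≤ ∑' k : ℤ, Real.exp (π ^ 2 / (2 * ε)) *
        ((1 - t) * Real.exp (-(y - 2 * π * k) ^ 2 / (2 * ε))
        + t * Real.exp (-(y + 2 * π - 2 * π * k) ^ 2 / (2 * ε))) :=
        Summable.tsum_le_tsum key (summable_theta hε _) (hs.mul_left _)
    _ = Real.exp (π ^ 2 / (2 * ε)) * ((1 - t) * theta ε y + t * theta ε (y + 2 * π)) := by
        rw [tsum_mul_left, (s1.mul_left _).tsum_add (s2.mul_left _), tsum_mul_left, tsum_mul_left]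
        rfl
    _ = _ := by rw [theta_periodic ε y]; ring

lemma hasSum_mul_of_nonneg {ι κ : Type*} {f : ι → ℝ} {g : κ → ℝ} {b : ℝ} (hf : Summable f)
    (hg : HasSum g b) (hf0 : ∀ k, 0 ≤ f k) (hg0 : ∀ k, 0 ≤ g k) :
    HasSum (fun x : ι × κ => f x.1 * g x.2) ((∑' k, f k) * b) :=
  hf.hasSum.mul hg (hf.mul_of_nonneg hg.summable hf0 hg0)

/-- Factorizes the lattice sum, so that every property of the kernel reduces to the one-dimensional
theta function. -/
lemma hasSum_prod_pi {d : ℕ} {a : Fin d → ℤ → ℝ} (h0 : ∀ i k, 0 ≤ a i k)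
    (hs : ∀ i, Summable (a i)) :
    HasSum (fun k : Fin d → ℤ => ∏ i, a i (k i)) (∏ i, ∑' k, a i k) := by
  induction d with
  | zero => simp
  | succ d ihd =>
    have ih := ihd (a := fun i => a i.succ) (fun i => h0 _) (fun i => hs _)
    have hm := hasSum_mul_of_nonneg (hs 0) ih (h0 0)
      fun k => Finset.prod_nonneg fun i _ => h0 _ _
    rw [Fin.prod_univ_succ, ← (Fin.consEquiv fun _ => ℤ).hasSum_iff]
    refine hm.congr_fun ?_
    intro k
    simp [Fin.consEquiv, Fin.prod_univ_succ]

/-! ### The kernel on the torus -/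

/-- The theta function on the circle. -/
def circleTheta (ε : ℝ) : AddCircle (2 * π) → ℝ := (theta_periodic ε).lift

lemma circleTheta_coe (ε x : ℝ) : circleTheta ε (x : AddCircle (2 * π)) = theta ε x := rfl

lemma continuous_circleTheta {ε : ℝ} (hε : 0 < ε) : Continuous (circleTheta ε) :=
  continuous_coinduced_dom.2 (continuous_theta hε)

lemma circleTheta_pos {ε : ℝ} (hε : 0 < ε) (x : AddCircle (2 * π)) : 0 < circleTheta ε x := by
  induction x using QuotientAddGroup.induction_on with | H x => exact theta_pos hε x

lemma circleTheta_neg (ε : ℝ) (x : AddCircle (2 * π)) :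
    circleTheta ε (-x) = circleTheta ε x := by
  induction x using QuotientAddGroup.induction_on with | H x => exact theta_neg ε x

lemma circleTheta_le_mul {ε : ℝ} (hε : 0 < ε) (x y : AddCircle (2 * π)) :
    circleTheta ε x ≤ Real.exp (π ^ 2 / (2 * ε)) * circleTheta ε y := by
  induction x using QuotientAddGroup.induction_on with | H x =>
  induction y using QuotientAddGroup.induction_on with | H y => exact theta_le_mul_theta hε x y

lemma circleTheta_midpoint {ε : ℝ} (hε : 0 < ε) (w : AddCircle (2 * π)) (a b : ℝ) :
    (circleTheta ε (w - ((a + b) / 2 : ℝ)) * Real.exp (((a + b) / 2) ^ 2 / (2 * ε))) ^ 2 ≤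
      (circleTheta ε (w - a) * Real.exp (a ^ 2 / (2 * ε))) *
        (circleTheta ε (w - b) * Real.exp (b ^ 2 / (2 * ε))) := by
  induction w using QuotientAddGroup.induction_on with | H w => exact theta_midpoint hε w a b

variable {d : ℕ}

lemma coe_rep (x : Torus d) (i : Fin d) : (rep x i : AddCircle (2 * π)) = x i :=
  AddCircle.coe_equivIco

lemma shiftNorm_sq (x : Fin d → ℝ) (k : Fin d → ℤ) :
    shiftNorm x k ^ 2 = ∑ i, (x i - 2 * π * k i) ^ 2 := by
  rw [shiftNorm, EuclideanSpace.real_norm_sq_eq]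

lemma gaussKernel_eq {ε : ℝ} (hε : 0 < ε) (x : Torus d) :
    gaussKernel ε x = 1 / √((2 * π * ε) ^ d) * ∏ i, circleTheta ε (x i) := by
  rw [gaussKernel]
  congr 1
  have h := hasSum_prod_pi (d := d)
    (a := fun i k => Real.exp (-(rep x i - 2 * π * k) ^ 2 / (2 * ε)))
    (fun _ _ => (Real.exp_pos _).le) (fun i => summable_theta hε _)
  have e : ∀ k : Fin d → ℤ, Real.exp (-(shiftNorm (rep x) k) ^ 2 / (2 * ε)) =
      ∏ i, Real.exp (-(rep x i - 2 * π * k i) ^ 2 / (2 * ε)) := by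
    intro k
    rw [← Real.exp_sum, shiftNorm_sq, ← Finset.sum_div, Finset.sum_neg_distrib]
  simp_rw [e, h.tsum_eq]
  refine Finset.prod_congr rfl fun i _ => ?_
  rw [← coe_rep x i, circleTheta_coe]; rfl

lemma gaussKernel_pos {ε : ℝ} (hε : 0 < ε) (x : Torus d) : 0 < gaussKernel ε x := by
  rw [gaussKernel_eq hε]
  have := Finset.prod_pos (s := Finset.univ) fun i _ => circleTheta_pos hε (x i)
  positivity

lemma continuous_gaussKernel {ε : ℝ} (hε : 0 < ε) :
    Continuous (gaussKernel ε : Torus d → ℝ) := by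
  have := continuous_circleTheta hε
  rw [show (gaussKernel ε : Torus d → ℝ) = _ from funext (gaussKernel_eq hε)]
  fun_prop

lemma gaussKernel_neg {ε : ℝ} (hε : 0 < ε) (x : Torus d) :
    gaussKernel ε (-x) = gaussKernel ε x := by
  simp [gaussKernel_eq hε, circleTheta_neg]

lemma gaussKernel_le_mul {ε : ℝ} (hε : 0 < ε) (x y : Torus d) :
    gaussKernel ε x ≤ Real.exp (d * (π ^ 2 / (2 * ε))) * gaussKernel ε y := by
  rw [gaussKernel_eq hε, gaussKernel_eq hε, mul_left_comm]
  gcongr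
  calc ∏ i, circleTheta ε (x i) ≤ ∏ i, (Real.exp (π ^ 2 / (2 * ε)) * circleTheta ε (y i)) :=
        Finset.prod_le_prod (fun i _ => (circleTheta_pos hε _).le)
          fun i _ => circleTheta_le_mul hε _ _
    _ = _ := by
        rw [Finset.prod_mul_distrib, Finset.prod_const, ← Real.exp_nat_mul]; simp

/-- The projection of `ℝ^d` onto the torus. -/
def toTorus (z : Fin d → ℝ) : Torus d := fun i => (z i : AddCircle (2 * π))

lemma continuous_toTorus : Continuous (toTorus : (Fin d → ℝ) → Torus d) :=
  continuous_pi fun i => (AddCircle.continuous_mk' _).comp (continuous_apply i)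

lemma gaussKernel_midpoint {ε : ℝ} (hε : 0 < ε) (w : Torus d) (a b : Fin d → ℝ) :
    (gaussKernel ε (w - toTorus (fun i => (a i + b i) / 2)) *
        Real.exp ((∑ i, ((a i + b i) / 2) ^ 2) / (2 * ε))) ^ 2 ≤
      (gaussKernel ε (w - toTorus a) * Real.exp ((∑ i, a i ^ 2) / (2 * ε))) *
        (gaussKernel ε (w - toTorus b) * Real.exp ((∑ i, b i ^ 2) / (2 * ε))) := by
  have e : ∀ z : Fin d → ℝ, gaussKernel ε (w - toTorus z) * Real.exp ((∑ i, z i ^ 2) / (2 * ε))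
      = 1 / √((2 * π * ε) ^ d) *
        ∏ i, (circleTheta ε (w i - (z i : AddCircle (2 * π))) * Real.exp (z i ^ 2 / (2 * ε))) := by
    intro z
    rw [gaussKernel_eq hε, Finset.prod_mul_distrib, ← Real.exp_sum, Finset.sum_div, mul_assoc]
    rfl
  rw [e, e a, e b, mul_pow, mul_mul_mul_comm, sq (1 / √_), ← Finset.prod_mul_distrib,
    ← Finset.prod_pow]
  gcongr with i
  exact circleTheta_midpoint hε _ _ _

/-! ### The Prékopa-Leindler inequality on a cube -/

/-- Proof by monotone transport: `Y` carries the normalized `f` to the normalized `g` on `[a, b]`,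
and the integral of `h` is computed through the substitution `x ↦ (x + Y x) / 2`, which fixes both
endpoints. -/
theorem prekopa_interval {f g h : ℝ → ℝ} (hf : Continuous f) (hg : Continuous g)
    (hh : Continuous h) (f0 : ∀ x, 0 < f x) (g0 : ∀ x, 0 < g x) (h0 : ∀ x, 0 < h x)
    (hfg : ∀ x y, f x * g y ≤ h ((x + y) / 2) ^ 2) {a b : ℝ} (hab : a < b) :
    (∫ x in a..b, f x) * (∫ x in a..b, g x) ≤ (∫ x in a..b, h x) ^ 2 := by
  set F := ∫ x in a..b, f x with hF
  set G := ∫ x in a..b, g x with hG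
  have F0 : 0 < F := intervalIntegral.intervalIntegral_pos_of_pos (hf.intervalIntegrable _ _) f0 hab
  have G0 : 0 < G := intervalIntegral.intervalIntegral_pos_of_pos (hg.intervalIntegrable _ _) g0 hab
  set Γ : ℝ → ℝ := fun y => ∫ x in a..y, g x with hΓ
  have dΓ : ∀ y, HasStrictDerivAt Γ (g y) y := fun y =>
    intervalIntegral.integral_hasStrictDerivAt_right (hg.intervalIntegrable _ _)
      (hg.stronglyMeasurableAtFilter _ _) hg.continuousAt
  have mΓ : StrictMono Γ := strictMono_of_deriv_pos fun y => by
    rw [(dΓ y).hasDerivAt.deriv]; exact g0 y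
  have cΓ : Continuous Γ := continuous_iff_continuousAt.2 fun y => (dΓ y).hasDerivAt.continuousAt
  -- Makes the inverse of the primitive of `g` available as a differentiable map.
  have oΓ : Topology.IsOpenEmbedding Γ :=
    .of_continuous_injective_isOpenMap cΓ mΓ.injective
      (isOpenMap_of_hasStrictDerivAt dΓ fun y => (g0 y).ne')
  set e := oΓ.toOpenPartialHomeomorph Γ with he
  -- The factor `G / F` equalizes the total masses, so that `Y b = b`.
  set c : ℝ → ℝ := fun x => (∫ s in a..x, f s) * (G / F) with hc
  have dc : ∀ x, HasDerivAt c (f x * (G / F)) x := fun x =>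
    (intervalIntegral.integral_hasDerivAt_right (hf.intervalIntegrable _ _)
      (hf.stronglyMeasurableAtFilter _ _) hf.continuousAt).mul_const _
  have ca : c a = Γ a := by simp [hc, hΓ]
  have cb : c b = Γ b := by
    change F * (G / F) = G
    field_simp
  have mc : Monotone c := monotone_of_deriv_nonneg (fun x => (dc x).differentiableAt) fun x => by
    rw [(dc x).deriv]; have := f0 x; positivity
  have hr : ∀ x ∈ Set.Icc a b, ∃ y, Γ y = c x := fun x hx => by
    have := intermediate_value_Icc hab.le cΓ.continuousOn
    obtain ⟨y, -, hy⟩ := this ⟨ca ▸ mc hx.1, cb ▸ mc hx.2⟩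
    exact ⟨y, hy⟩
  set Y : ℝ → ℝ := fun x => e.symm (c x) with hY
  have eY : ∀ x ∈ Set.Icc a b, Γ (Y x) = c x := fun x hx => by
    obtain ⟨y, hy⟩ := hr x hx
    exact e.right_inv (by rw [← hy]; exact ⟨y, by simp⟩)
  have Ya : Y a = a := mΓ.injective ((eY a ⟨le_rfl, hab.le⟩).trans ca)
  have Yb : Y b = b := mΓ.injective ((eY b ⟨hab.le, le_rfl⟩).trans cb)
  have dY : ∀ x ∈ Set.Icc a b, HasDerivAt Y ((g (Y x))⁻¹ * (f x * (G / F))) x := fun x hx => by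
    obtain ⟨y, hy⟩ := hr x hx
    refine HasDerivAt.comp x (h₂ := e.symm) ?_ (dc x)
    refine e.hasDerivAt_symm (by rw [← hy]; exact ⟨y, by simp⟩) (g0 _).ne' ?_
    exact (dΓ _).hasDerivAt
  have cY : ContinuousOn Y (Set.Icc a b) := fun x hx => (dY x hx).continuousAt.continuousWithinAt
  have dZ : ∀ x ∈ Set.uIcc a b, HasDerivAt (fun x => (x + Y x) / 2)
      ((1 + (g (Y x))⁻¹ * (f x * (G / F))) / 2) x := fun x hx => by
    rw [Set.uIcc_of_le hab.le] at hx
    exact ((hasDerivAt_id x).add (dY x hx)).div_const 2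
  have cZ' : ContinuousOn (fun x => (1 + (g (Y x))⁻¹ * (f x * (G / F))) / 2) (Set.uIcc a b) := by
    rw [Set.uIcc_of_le hab.le]
    have hi : ContinuousOn (fun x => (g (Y x))⁻¹) (Set.Icc a b) :=
      (hg.comp_continuousOn cY).inv₀ fun x _ => (g0 (Y x)).ne'
    exact (continuousOn_const.add (hi.mul (hf.mul_const _).continuousOn)).div_const 2
  have key := intervalIntegral.integral_comp_mul_deriv dZ cZ' hh
  simp only [Ya, Yb, add_self_div_two] at key
  have hi : F * √(G / F) ≤ ∫ x in a..b, h x := by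
    rw [← key, hF, ← intervalIntegral.integral_mul_const]
    refine intervalIntegral.integral_mono_on hab.le ((hf.mul_const _).intervalIntegrable _ _)
      ?_ fun x hx => ?_
    · refine ContinuousOn.intervalIntegrable ?_
      refine ContinuousOn.mul (hh.comp_continuousOn fun x hx => ?_) cZ'
      exact (dZ x hx).continuousAt.continuousWithinAt
    · have hgY := g0 (Y x)
      have hfx := f0 x
      have hH := h0 ((x + Y x) / 2)
      refine le_of_abs_le (abs_le_of_sq_le_sq ?_ (by simp only [Function.comp]; positivity))
      rw [mul_pow, mul_pow, Real.sq_sqrt (by positivity)]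
      set p := (g (Y x))⁻¹ * (f x * (G / F)) with hp
      -- Here `p` is `Y'(x)` and `(1 + p) / 2` is the Jacobian of the substitution. The
      -- arithmetic-geometric mean inequality absorbs `Y'`.
      have h1 : p ≤ ((1 + p) / 2) ^ 2 := by nlinarith [sq_nonneg (1 - p)]
      have p0 : 0 ≤ p := by positivity
      calc f x ^ 2 * (G / F) = (f x * g (Y x)) * p := by rw [hp]; field_simp
        _ ≤ h ((x + Y x) / 2) ^ 2 * ((1 + p) / 2) ^ 2 :=
          mul_le_mul (hfg _ _) h1 p0 (by positivity)
  calc F * G = (F * √(G / F)) ^ 2 := by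
        rw [mul_pow, Real.sq_sqrt (by positivity)]; field_simp
    _ ≤ _ := by gcongr

/-- Lebesgue measure on the cube `(0, 2π]^d`. -/
def cubeMeasure (d : ℕ) : Measure (Fin d → ℝ) :=
  Measure.pi fun _ => volume.restrict (Set.Ioc 0 (2 * π))

lemma cubeMeasure_eq (d : ℕ) :
    cubeMeasure d = volume.restrict (Set.univ.pi fun _ => Set.Ioc 0 (2 * π)) :=
  (Measure.restrict_pi_pi (fun _ => volume) _).symm

instance (d : ℕ) : IsFiniteMeasure (cubeMeasure d) := by
  unfold cubeMeasure; infer_instance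

lemma integrable_cubeMeasure {d : ℕ} {f : (Fin d → ℝ) → ℝ} (hf : Continuous f) :
    Integrable f (cubeMeasure d) := by
  rw [cubeMeasure_eq]
  refine (hf.continuousOn.integrableOn_compact
    (isCompact_univ_pi fun _ => isCompact_Icc (a := 0) (b := 2 * π))).mono_set ?_
  exact Set.pi_mono fun _ _ => Set.Ioc_subset_Icc_self

lemma integral_cubeMeasure_succ {d : ℕ} {f : (Fin (d + 1) → ℝ) → ℝ} (hf : Continuous f) :
    ∫ z, f z ∂(cubeMeasure (d + 1)) =
      ∫ z, (∫ s in (0)..(2 * π), f (Fin.cons s z)) ∂(cubeMeasure d) := by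
  have mp := (measurePreserving_piFinSuccAbove
    (fun _ : Fin (d + 1) => volume.restrict (Set.Ioc 0 (2 * π))) 0).symm
  have hi := (mp.integrable_comp_emb (MeasurableEquiv.measurableEmbedding _)).2
    (integrable_cubeMeasure hf)
  have e : (f ∘ (MeasurableEquiv.piFinSuccAbove (fun _ => ℝ) (0 : Fin (d + 1))).symm) =
      fun p : ℝ × (Fin d → ℝ) => f (Fin.cons p.1 p.2) := by
    ext p
    simp [MeasurableEquiv.piFinSuccAbove_symm_apply, Fin.insertNthEquiv]
  rw [e] at hi
  rw [cubeMeasure, ← mp.integral_comp']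
  change ∫ p, (f ∘ (MeasurableEquiv.piFinSuccAbove (fun _ => ℝ) (0 : Fin (d + 1))).symm) p ∂_ = _
  rw [e]
  simp_rw [intervalIntegral.integral_of_le Real.two_pi_pos.le]
  exact integral_prod_symm _ hi

/-- Induction on the dimension by Fubini: the one-dimensional inequality in the first coordinate
shows that the partial integrals satisfy the midpoint hypothesis in the remaining ones. -/
theorem prekopa_cube {d : ℕ} {f g h : (Fin d → ℝ) → ℝ} (hf : Continuous f) (hg : Continuous g)
    (hh : Continuous h) (f0 : ∀ x, 0 < f x) (g0 : ∀ x, 0 < g x) (h0 : ∀ x, 0 < h x)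
    (hfg : ∀ x y, f x * g y ≤ h (fun i => (x i + y i) / 2) ^ 2) :
    (∫ x, f x ∂(cubeMeasure d)) * (∫ x, g x ∂(cubeMeasure d)) ≤
      (∫ x, h x ∂(cubeMeasure d)) ^ 2 := by
  induction d with
  | zero =>
    have e : ∀ k : (Fin 0 → ℝ) → ℝ, ∫ x, k x ∂(cubeMeasure 0) = k 0 := fun k => by
      rw [cubeMeasure, Measure.pi_of_empty (x := 0)]; simp
    rw [e, e, e]
    convert hfg 0 0 using 3
  | succ d ih =>
    have hc : Continuous fun p : (Fin d → ℝ) × ℝ => (Fin.cons p.2 p.1 : Fin (d + 1) → ℝ) := by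
      fun_prop
    have hcs : ∀ z : Fin d → ℝ, Continuous fun s : ℝ => (Fin.cons s z : Fin (d + 1) → ℝ) :=
      fun z => by fun_prop
    have int_cont : ∀ k : (Fin (d + 1) → ℝ) → ℝ, Continuous k →
        Continuous fun z : Fin d → ℝ => ∫ s in (0)..(2 * π), k (Fin.cons s z) := fun k hk =>
      intervalIntegral.continuous_parametric_intervalIntegral_of_continuous'
        (f := fun (z : Fin d → ℝ) s => k (Fin.cons s z)) (hk.comp hc) _ _
    have int_pos : ∀ k : (Fin (d + 1) → ℝ) → ℝ, Continuous k → (∀ x, 0 < k x) →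
        ∀ z : Fin d → ℝ, 0 < ∫ s in (0)..(2 * π), k (Fin.cons s z) := fun k hk k0 z =>
      intervalIntegral.intervalIntegral_pos_of_pos ((hk.comp (hcs z)).intervalIntegrable _ _)
        (fun s => k0 _) Real.two_pi_pos
    rw [integral_cubeMeasure_succ hf, integral_cubeMeasure_succ hg, integral_cubeMeasure_succ hh]
    refine ih (int_cont f hf) (int_cont g hg) (int_cont h hh) (int_pos f hf f0)
      (int_pos g hg g0) (int_pos h hh h0) fun x y => ?_
    refine prekopa_interval (hf.comp (hcs x)) (hg.comp (hcs y)) (hh.comp (hcs _))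
      (fun s => f0 _) (fun s => g0 _) (fun s => h0 _) (fun s t => ?_) Real.two_pi_pos
    refine (hfg _ _).trans (le_of_eq ?_)
    simp only [Function.comp]
    congr 2
    ext i
    refine Fin.cases ?_ (fun j => ?_) i <;> simp

/-! ### Parametric integrals of continuous functions -/

section Parametric

variable {W : Type*} [TopologicalSpace W]
  [MeasurableSpace W] [OpensMeasurableSpace W] {μ : Measure W} [IsFiniteMeasure μ] {K : Set W}

/-- A single four-term shape for the expansions below; coefficients that are not needed are set to
`0`. -/
lemma integral_linear_comb {W : Type*} [MeasurableSpace W] {μ : Measure W} {f g h k : W → ℝ}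
    (hf : Integrable f μ) (hg : Integrable g μ) (hh : Integrable h μ) (hk : Integrable k μ)
    (a b c e : ℝ) : ∫ w, (a * f w + b * g w + c * h w + e * k w) ∂μ =
      a * ∫ w, f w ∂μ + b * ∫ w, g w ∂μ + c * ∫ w, h w ∂μ + e * ∫ w, k w ∂μ := by
  have h1 : Integrable (fun w => a * f w + b * g w) μ := (hf.const_mul a).add (hg.const_mul b)
  have h2 : Integrable (fun w => a * f w + b * g w + c * h w) μ := h1.add (hh.const_mul c)
  rw [integral_add h2 (hk.const_mul e), integral_add h1 (hh.const_mul c),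
    integral_add (hf.const_mul a) (hg.const_mul b), integral_const_mul, integral_const_mul,
    integral_const_mul, integral_const_mul]

lemma integrable_of_continuous_of_ae_mem (hK : IsCompact K) (hμ : ∀ᵐ w ∂μ, w ∈ K) {f : W → ℝ}
    (hf : Continuous f) : Integrable f μ := by
  obtain ⟨C, hC⟩ := hK.exists_bound_of_continuousOn hf.continuousOn
  exact Integrable.of_bound hf.aestronglyMeasurable C (hμ.mono hC)

lemma continuous_integral_of_ae_mem {A : Type*} [TopologicalSpace A] [FirstCountableTopology A]
    [LocallyCompactSpace A] (hK : IsCompact K) (hμ : ∀ᵐ w ∂μ, w ∈ K) {F : A → W → ℝ}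
    (hF : Continuous F.uncurry) : Continuous fun a => ∫ w, F a w ∂μ := by
  have := continuous_parametric_integral_of_continuous (μ := μ) hF hK
  rwa [Measure.restrict_eq_self_of_ae_mem hμ] at this

/-- Concentration on a compact set covers both the torus (`K = univ`) and the cube measure on the
non-compact space `ℝ^d`. -/
lemma hasDerivAt_integral_of_ae_mem (hK : IsCompact K) (hμ : ∀ᵐ w ∂μ, w ∈ K) {F F' : ℝ → W → ℝ}
    (hF : Continuous F.uncurry) (hF' : Continuous F'.uncurry)
    (hd : ∀ t w, HasDerivAt (fun t => F t w) (F' t w) t) (t : ℝ) :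
    HasDerivAt (fun t => ∫ w, F t w ∂μ) (∫ w, F' t w ∂μ) t := by
  obtain ⟨C, hC⟩ := ((isCompact_closedBall t 1).prod hK).exists_bound_of_continuousOn
    hF'.continuousOn
  have hs : ∀ t, Continuous (F t) := fun t => hF.comp (Continuous.prodMk_right t)
  have hs' : ∀ t, Continuous (F' t) := fun t => hF'.comp (Continuous.prodMk_right t)
  exact (hasDerivAt_integral_of_dominated_loc_of_deriv_le (bound := fun _ => C)
    (Metric.closedBall_mem_nhds t one_pos)
    (Filter.Eventually.of_forall fun t => (hs t).aestronglyMeasurable)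
    (integrable_of_continuous_of_ae_mem hK hμ (hs t)) (hs' t).aestronglyMeasurable
    (hμ.mono fun w hw x hx => hC (x, w) ⟨hx, hw⟩) (integrable_const C)
    (Filter.Eventually.of_forall fun w x _ => hd x w)).2

end Parametric

section CompactSpace

variable {W : Type*} [TopologicalSpace W] [CompactSpace W]
  [MeasurableSpace W] [OpensMeasurableSpace W] {μ : Measure W} [IsFiniteMeasure μ]

lemma integrable_of_continuous {f : W → ℝ} (hf : Continuous f) : Integrable f μ :=
  integrable_of_continuous_of_ae_mem isCompact_univ (by simp) hf

/-- Chebyshev's correlation inequality: integrate `(p w - p w') (q w - q w') ≥ 0` against `k w * k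
w'`, first in `w'`, then in `w`. -/
lemma integral_mul_integral_le_of_monovary {p q k : W → ℝ} (hp : Continuous p)
    (hq : Continuous q) (hk : Continuous k) (k0 : ∀ w, 0 ≤ k w)
    (hpq : ∀ w w', 0 ≤ (p w - p w') * (q w - q w')) :
    (∫ w, p w * k w ∂μ) * (∫ w, q w * k w ∂μ) ≤
      (∫ w, k w ∂μ) * ∫ w, p w * q w * k w ∂μ := by
  have ik := integrable_of_continuous (μ := μ) hk
  have ip : Integrable (fun w => p w * k w) μ := integrable_of_continuous (hp.mul hk)
  have iq : Integrable (fun w => q w * k w) μ := integrable_of_continuous (hq.mul hk)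
  have ipq : Integrable (fun w => p w * q w * k w) μ :=
    integrable_of_continuous ((hp.mul hq).mul hk)
  set a := ∫ w, k w ∂μ
  set b := ∫ w, p w * k w ∂μ
  set c := ∫ w, q w * k w ∂μ
  set e := ∫ w, p w * q w * k w ∂μ
  have h1 : ∀ w, 0 ≤ p w * q w * a - p w * c - q w * b + e := fun w => by
    have : p w * q w * a - p w * c - q w * b + e
        = ∫ w', (p w - p w') * (q w - q w') * k w' ∂μ := by
      have := integral_linear_comb ik iq ip ipq (p w * q w) (-p w) (-q w) 1
      rw [show (p w * q w * a - p w * c - q w * b + e) =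
        p w * q w * a + -p w * c + -q w * b + 1 * e by ring]
      refine this.symm.trans ?_
      congr 1; ext w'; ring
    rw [this]
    exact integral_nonneg fun w' => mul_nonneg (hpq _ _) (k0 _)
  have h2 : 0 ≤ ∫ w, (p w * q w * a - p w * c - q w * b + e) * k w ∂μ :=
    integral_nonneg fun w => mul_nonneg (h1 w) (k0 _)
  have h3 : ∫ w, (p w * q w * a - p w * c - q w * b + e) * k w ∂μ
      = a * e - c * b - b * c + e * a := by
    have := integral_linear_comb ipq ip iq ik a (-c) (-b) e
    rw [show a * e - c * b - b * c + e * a = a * e + -c * b + -b * c + e * a by ring]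
    refine Eq.trans ?_ this
    congr 1; ext w; ring
  rw [h3] at h2
  linarith

end CompactSpace

/-! ### Moments of the exponentially tilted kernel -/

/-- `∫ X^j exp(t X) K_ε(· - y) dρ`. -/
def tiltMoment (ε : ℝ) (ρ : Measure (Torus d)) (X : Torus d → ℝ) (j : ℕ) (t : ℝ) (y : Torus d) :
    ℝ :=
  ∫ w, X w ^ j * Real.exp (t * X w) * gaussKernel ε (w - y) ∂ρ

/-- The mean of `X` under the tilted kernel. -/
def tiltMean (ε : ℝ) (ρ : Measure (Torus d)) (X : Torus d → ℝ) (t : ℝ) (y : Torus d) : ℝ :=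
  tiltMoment ε ρ X 1 t y / tiltMoment ε ρ X 0 t y

/-- The mean of `X²` under the tilted kernel. -/
def tiltSecond (ε : ℝ) (ρ : Measure (Torus d)) (X : Torus d → ℝ) (t : ℝ) (y : Torus d) : ℝ :=
  tiltMoment ε ρ X 2 t y / tiltMoment ε ρ X 0 t y

/-- The variance of `X` under the tilted kernel. -/
def tiltVar (ε : ℝ) (ρ : Measure (Torus d)) (X : Torus d → ℝ) (t : ℝ) (y : Torus d) : ℝ :=
  tiltSecond ε ρ X t y - tiltMean ε ρ X t y ^ 2

section Moments

variable {ε : ℝ} {ρ : Measure (Torus d)} [IsFiniteMeasure ρ] {X : Torus d → ℝ}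

lemma continuous_tiltMoment (hε : 0 < ε) (hX : Continuous X) (j : ℕ) :
    Continuous (tiltMoment ε ρ X j).uncurry := by
  have hk := continuous_gaussKernel (d := d) hε
  have := continuous_integral_of_ae_mem (A := ℝ × Torus d) (μ := ρ) isCompact_univ (by simp)
    (F := fun p w => X w ^ j * Real.exp (p.1 * X w) * gaussKernel ε (w - p.2))
    (by simp only [Function.uncurry_def]; fun_prop)
  exact this

lemma hasDerivAt_tiltMoment (hε : 0 < ε) (hX : Continuous X) (j : ℕ) (t : ℝ) (y : Torus d) :
    HasDerivAt (fun t => tiltMoment ε ρ X j t y) (tiltMoment ε ρ X (j + 1) t y) t := by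
  have hk := continuous_gaussKernel (d := d) hε
  refine hasDerivAt_integral_of_ae_mem (μ := ρ) isCompact_univ (by simp)
    (F := fun t w => X w ^ j * Real.exp (t * X w) * gaussKernel ε (w - y))
    (F' := fun t w => X w ^ (j + 1) * Real.exp (t * X w) * gaussKernel ε (w - y))
    (by simp only [Function.uncurry_def]; fun_prop)
    (by simp only [Function.uncurry_def]; fun_prop) (fun t w => ?_) t
  have := ((((hasDerivAt_id t).mul_const (X w)).exp).const_mul (X w ^ j)).mul_const
    (gaussKernel ε (w - y))
  refine this.congr_deriv ?_
  simp only [id]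
  ring

lemma integrable_tiltMoment (hε : 0 < ε) (hX : Continuous X) (j : ℕ) (t : ℝ) (y : Torus d) :
    Integrable (fun w => X w ^ j * Real.exp (t * X w) * gaussKernel ε (w - y)) ρ := by
  have hk := continuous_gaussKernel (d := d) hε
  exact integrable_of_continuous (by fun_prop)

lemma tiltMoment_zero_pos [NeZero ρ] (hε : 0 < ε) (hX : Continuous X) (t : ℝ) (y : Torus d) :
    0 < tiltMoment ε ρ X 0 t y := by
  have h : ∀ w, 0 < X w ^ 0 * Real.exp (t * X w) * gaussKernel ε (w - y) := fun w => by
    have := gaussKernel_pos hε (w - y)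
    positivity
  rw [tiltMoment, integral_pos_iff_support_of_nonneg (fun w => (h w).le)
    (integrable_tiltMoment hε hX 0 t y)]
  rw [show (Function.support fun w => X w ^ 0 * Real.exp (t * X w) * gaussKernel ε (w - y))
    = Set.univ from Set.eq_univ_of_forall fun w => (h w).ne']
  exact NeZero.pos _

lemma continuous_tiltMean [NeZero ρ] (hε : 0 < ε) (hX : Continuous X) :
    Continuous (tiltMean ε ρ X).uncurry :=
  (continuous_tiltMoment hε hX 1).div (continuous_tiltMoment hε hX 0)
    fun _ => (tiltMoment_zero_pos hε hX _ _).ne'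

lemma continuous_tiltSecond [NeZero ρ] (hε : 0 < ε) (hX : Continuous X) :
    Continuous (tiltSecond ε ρ X).uncurry :=
  (continuous_tiltMoment hε hX 2).div (continuous_tiltMoment hε hX 0)
    fun _ => (tiltMoment_zero_pos hε hX _ _).ne'

lemma continuous_tiltVar [NeZero ρ] (hε : 0 < ε) (hX : Continuous X) :
    Continuous (tiltVar ε ρ X).uncurry :=
  (continuous_tiltSecond hε hX).sub ((continuous_tiltMean hε hX).pow 2)

lemma hasDerivAt_log_tiltMoment [NeZero ρ] (hε : 0 < ε) (hX : Continuous X) (t : ℝ)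
    (y : Torus d) :
    HasDerivAt (fun t => Real.log (tiltMoment ε ρ X 0 t y)) (tiltMean ε ρ X t y) t :=
  (hasDerivAt_tiltMoment hε hX 0 t y).log (tiltMoment_zero_pos hε hX t y).ne'

lemma hasDerivAt_tiltMean [NeZero ρ] (hε : 0 < ε) (hX : Continuous X) (t : ℝ) (y : Torus d) :
    HasDerivAt (fun t => tiltMean ε ρ X t y) (tiltVar ε ρ X t y) t := by
  have h0 := (tiltMoment_zero_pos (ρ := ρ) hε hX t y).ne'
  refine ((hasDerivAt_tiltMoment hε hX 1 t y).div
    (hasDerivAt_tiltMoment hε hX 0 t y) h0).congr_deriv ?_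
  simp only [tiltVar, tiltSecond, tiltMean]
  field_simp

lemma integral_sub_sq_mul_tilt (hε : 0 < ε) (hX : Continuous X) (t c : ℝ) (y : Torus d) :
    ∫ w, (X w - c) ^ 2 * (Real.exp (t * X w) * gaussKernel ε (w - y)) ∂ρ =
      tiltMoment ε ρ X 2 t y - 2 * c * tiltMoment ε ρ X 1 t y
        + c ^ 2 * tiltMoment ε ρ X 0 t y := by
  have i := fun j => integrable_tiltMoment (ρ := ρ) hε hX j t y
  have := integral_linear_comb (i 2) (i 1) (i 0) (i 0) 1 (-(2 * c)) (c ^ 2) 0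
  simp only [tiltMoment]
  rw [sub_eq_add_neg, ← neg_mul, ← one_mul (∫ w, X w ^ 2 * _ * _ ∂ρ), ← add_zero (_ + _),
    ← zero_mul (∫ w, X w ^ 0 * Real.exp (t * X w) * gaussKernel ε (w - y) ∂ρ), ← this]
  congr 1; ext w; ring

lemma tiltVar_nonneg [NeZero ρ] (hε : 0 < ε) (hX : Continuous X) (t : ℝ) (y : Torus d) :
    0 ≤ tiltVar ε ρ X t y := by
  have h0 := tiltMoment_zero_pos (ρ := ρ) hε hX t y
  have h := integral_sub_sq_mul_tilt (ρ := ρ) hε hX t (tiltMean ε ρ X t y) y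
  have hn : 0 ≤ ∫ w, (X w - tiltMean ε ρ X t y) ^ 2 *
      (Real.exp (t * X w) * gaussKernel ε (w - y)) ∂ρ := integral_nonneg fun w => by
    have := gaussKernel_pos hε (w - y)
    positivity
  rw [h] at hn
  have e : tiltVar ε ρ X t y = (tiltMoment ε ρ X 2 t y
      - 2 * tiltMean ε ρ X t y * tiltMoment ε ρ X 1 t y
        + tiltMean ε ρ X t y ^ 2 * tiltMoment ε ρ X 0 t y) / tiltMoment ε ρ X 0 t y := by
    simp only [tiltVar, tiltSecond, tiltMean]
    field_simp
    ring
  rw [e]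
  positivity

lemma tiltMean_mem_Icc [NeZero ρ] (hε : 0 < ε) (hX : Continuous X) {a b : ℝ}
    (hab : ∀ w, X w ∈ Set.Icc a b) (t : ℝ) (y : Torus d) :
    tiltMean ε ρ X t y ∈ Set.Icc a b := by
  have h0 := tiltMoment_zero_pos (ρ := ρ) hε hX t y
  have i := fun j => integrable_tiltMoment (ρ := ρ) hε hX j t y
  have hp : ∀ w, 0 ≤ Real.exp (t * X w) * gaussKernel ε (w - y) := fun w => by
    have := gaussKernel_pos hε (w - y)
    positivity
  constructor
  · rw [tiltMean, le_div_iff₀ h0, tiltMoment, tiltMoment, ← integral_const_mul]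
    refine integral_mono ((i 0).const_mul _) (i 1) fun w => ?_
    have := mul_le_mul_of_nonneg_right (hab w).1 (hp w)
    simp only [pow_zero, pow_one]; linarith
  · rw [tiltMean, div_le_iff₀ h0, tiltMoment, tiltMoment, ← integral_const_mul]
    refine integral_mono (i 1) ((i 0).const_mul _) fun w => ?_
    have := mul_le_mul_of_nonneg_right (hab w).2 (hp w)
    simp only [pow_zero, pow_one]; linarith

/-- Tilting by `exp(t X)` increases the mean of `(X - c)² + 2 s X`, which is a nondecreasing
function of `X` when `|X - c| ≤ s`. -/
lemma tiltSecond_add_mono [NeZero ρ] (hε : 0 < ε) (hX : Continuous X) {t c s : ℝ} (ht : 0 ≤ t)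
    (hs : ∀ w, |X w - c| ≤ s) (y : Torus d) :
    tiltSecond ε ρ X 0 y + (2 * s - 2 * c) * tiltMean ε ρ X 0 y ≤
      tiltSecond ε ρ X t y + (2 * s - 2 * c) * tiltMean ε ρ X t y := by
  have hk := continuous_gaussKernel (d := d) hε
  have h0 := tiltMoment_zero_pos (ρ := ρ) hε hX 0 y
  have h1 := tiltMoment_zero_pos (ρ := ρ) hε hX t y
  have i := fun j t => integrable_tiltMoment (ρ := ρ) hε hX j t y
  -- Up to a constant, `q` is `(X - c)² + 2sX`, which is ordered in the same way as `exp(tX)`.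
  have key := integral_mul_integral_le_of_monovary (μ := ρ) (p := fun w => Real.exp (t * X w))
    (q := fun w => X w ^ 2 + (2 * s - 2 * c) * X w) (k := fun w => gaussKernel ε (w - y))
    (by fun_prop) (by fun_prop) (by fun_prop) (fun w => (gaussKernel_pos hε _).le) ?_
  · have e1 : ∫ w, Real.exp (t * X w) * gaussKernel ε (w - y) ∂ρ = tiltMoment ε ρ X 0 t y := by
      simp [tiltMoment]
    have e2 : ∫ w, gaussKernel ε (w - y) ∂ρ = tiltMoment ε ρ X 0 0 y := by
      simp [tiltMoment]
    have e3 : ∫ w, (X w ^ 2 + (2 * s - 2 * c) * X w) * gaussKernel ε (w - y) ∂ρ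
        = tiltMoment ε ρ X 2 0 y + (2 * s - 2 * c) * tiltMoment ε ρ X 1 0 y := by
      rw [tiltMoment, tiltMoment, ← integral_const_mul,
        ← integral_add (i 2 0) ((i 1 0).const_mul _)]
      congr 1; ext w; simp; ring
    have e4 : ∫ w, Real.exp (t * X w) * (X w ^ 2 + (2 * s - 2 * c) * X w)
          * gaussKernel ε (w - y) ∂ρ
        = tiltMoment ε ρ X 2 t y + (2 * s - 2 * c) * tiltMoment ε ρ X 1 t y := by
      rw [tiltMoment, tiltMoment, ← integral_const_mul,
        ← integral_add (i 2 t) ((i 1 t).const_mul _)]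
      congr 1; ext w; simp; ring
    rw [e1, e2, e3, e4] at key
    have e5 : ∀ t, tiltSecond ε ρ X t y + (2 * s - 2 * c) * tiltMean ε ρ X t y =
        (tiltMoment ε ρ X 2 t y + (2 * s - 2 * c) * tiltMoment ε ρ X 1 t y) /
          tiltMoment ε ρ X 0 t y := fun t => by
      simp only [tiltSecond, tiltMean]; ring
    rw [e5, e5, div_le_div_iff₀ h0 h1]
    linarith
  · intro w w'
    have hw := abs_le.1 (hs w)
    have hw' := abs_le.1 (hs w')
    have e : (X w ^ 2 + (2 * s - 2 * c) * X w) - (X w' ^ 2 + (2 * s - 2 * c) * X w')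
        = (X w - X w') * ((X w - c + s) + (X w' - c + s)) := by ring
    simp only [e]
    rcases le_total (X w) (X w') with h | h
    · refine mul_nonneg_of_nonpos_of_nonpos ?_ ?_
      · exact sub_nonpos.2 (Real.exp_le_exp.2 (mul_le_mul_of_nonneg_left h ht))
      · exact mul_nonpos_of_nonpos_of_nonneg (by linarith) (by linarith)
    · refine mul_nonneg ?_ (mul_nonneg (by linarith) (by linarith))
      exact sub_nonneg.2 (Real.exp_le_exp.2 (mul_le_mul_of_nonneg_left h ht))

end Moments

/-! ### Midpoint log-concavity and second derivatives -/

/-- The function `G(s) = N(t - s) N(t + s)` has a maximum at `0` and `G''(0) = 2(N N₂ - N₁²)`. Were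
this positive, `0` would also be a local minimum, so `G` would be constant nearby and `G''(0) = 0`.
-/
lemma mul_le_sq_of_midpoint_logConcave {N N₁ N₂ : ℝ → ℝ} (h1 : ∀ t, HasDerivAt N (N₁ t) t)
    (h2 : ∀ t, HasDerivAt N₁ (N₂ t) t) {t : ℝ} (h : ∀ s, N (t - s) * N (t + s) ≤ N t ^ 2) :
    N t * N₂ t ≤ N₁ t ^ 2 := by
  set G : ℝ → ℝ := fun s => N (t - s) * N (t + s) with hG
  have a1 : ∀ s, HasDerivAt (fun s => N (t - s)) (-N₁ (t - s)) s := fun s =>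
    (h1 (t - s)).comp_const_sub t s
  have a2 : ∀ s, HasDerivAt (fun s => N (t + s)) (N₁ (t + s)) s := fun s =>
    (h1 (t + s)).comp_const_add t s
  have b1 : ∀ s, HasDerivAt (fun s => N₁ (t - s)) (-N₂ (t - s)) s := fun s =>
    (h2 (t - s)).comp_const_sub t s
  have b2 : ∀ s, HasDerivAt (fun s => N₁ (t + s)) (N₂ (t + s)) s := fun s =>
    (h2 (t + s)).comp_const_add t s
  have d1 : ∀ s, HasDerivAt G (-N₁ (t - s) * N (t + s) + N (t - s) * N₁ (t + s)) s :=
    fun s => (a1 s).mul (a2 s)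
  have e1 : deriv G = fun s => -N₁ (t - s) * N (t + s) + N (t - s) * N₁ (t + s) :=
    funext fun s => (d1 s).deriv
  have d2 : HasDerivAt (deriv G) (2 * (N t * N₂ t - N₁ t ^ 2)) 0 := by
    rw [e1]
    refine (((b1 0).neg.mul (a2 0)).add ((a1 0).mul (b2 0))).congr_deriv ?_
    simp only [sub_zero, add_zero, Pi.neg_apply]
    ring
  by_contra hlt
  rw [not_le] at hlt
  have hmin : IsLocalMin G 0 := by
    refine isLocalMin_of_deriv_deriv_pos (by rw [d2.deriv]; linarith) ?_ (d1 0).continuousAt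
    rw [e1]
    simp only [sub_zero, add_zero]
    ring
  have hconst : G =ᶠ[nhds 0] fun _ => G 0 := by
    filter_upwards [hmin] with s hs
    refine le_antisymm ((h s).trans (le_of_eq ?_)) hs
    simp [hG, sq]
  have h0 : deriv (deriv G) 0 = 0 := by
    rw [hconst.deriv.deriv_eq]
    simp
  rw [d2.deriv] at h0
  linarith

/-! ### The cube as a fundamental domain -/

lemma ae_mem_cube (d : ℕ) :
    ∀ᵐ z ∂(cubeMeasure d), z ∈ Set.univ.pi fun _ : Fin d => Set.Icc (0 : ℝ) (2 * π) := by
  rw [cubeMeasure_eq]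
  filter_upwards [ae_restrict_mem (MeasurableSet.univ_pi fun _ => measurableSet_Ioc)] with z hz
  exact Set.pi_mono (fun _ _ => Set.Ioc_subset_Icc_self) hz

lemma isCompact_cube (d : ℕ) :
    IsCompact (Set.univ.pi fun _ : Fin d => Set.Icc (0 : ℝ) (2 * π)) :=
  isCompact_univ_pi fun _ => isCompact_Icc

lemma measurePreserving_toTorus (d : ℕ) :
    MeasurePreserving (toTorus : (Fin d → ℝ) → Torus d) (cubeMeasure d) volume := by
  have h := fun _ : Fin d => AddCircle.measurePreserving_mk (2 * π) 0
  simp only [zero_add] at h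
  exact measurePreserving_pi _ _ h

lemma integral_torus_eq {f : Torus d → ℝ} (hf : Continuous f) :
    ∫ x, f x = ∫ z, f (toTorus z) ∂(cubeMeasure d) := by
  have h := measurePreserving_toTorus d
  rw [← h.map_eq, integral_map h.measurable.aemeasurable]
  rw [h.map_eq]
  exact hf.aestronglyMeasurable

/-! ### The log-concave weight on the cube -/

/-- The weight `(∫ exp(t X) K_ε(· - z) dρ)^(-ε) exp(-‖z‖² / 2)`. -/
def tiltWeight (ε : ℝ) (ρ : Measure (Torus d)) (X : Torus d → ℝ) (t : ℝ) (z : Fin d → ℝ) : ℝ :=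
  tiltMoment ε ρ X 0 t (toTorus z) ^ (-ε) * Real.exp (-(∑ i, z i ^ 2) / 2)

section Weight

variable {ε : ℝ} {ρ : Measure (Torus d)} [IsFiniteMeasure ρ] [NeZero ρ] {X : Torus d → ℝ}

lemma tiltWeight_pos (hε : 0 < ε) (hX : Continuous X) (t : ℝ) (z : Fin d → ℝ) :
    0 < tiltWeight ε ρ X t z := by
  have := tiltMoment_zero_pos (ρ := ρ) hε hX t (toTorus z)
  unfold tiltWeight
  positivity

/-- In this form log-concavity of the weight is log-convexity of the base, since the exponent is
negative. -/
lemma tiltWeight_eq (hε : 0 < ε) (hX : Continuous X) (t : ℝ) (z : Fin d → ℝ) :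
    tiltWeight ε ρ X t z =
      (tiltMoment ε ρ X 0 t (toTorus z) * Real.exp ((∑ i, z i ^ 2) / (2 * ε))) ^ (-ε) := by
  rw [Real.mul_rpow (tiltMoment_zero_pos hε hX t _).le (Real.exp_pos _).le, ← Real.exp_mul,
    tiltWeight]
  congr 2
  field_simp

/-- Joint log-convexity in time and space: `exp(tX)` is log-affine in `t`, the Gaussian-corrected
kernel is log-convex in `z`, and Cauchy-Schwarz passes this through the integral. -/
lemma tiltMoment_midpoint (hε : 0 < ε) (hX : Continuous X) (t s : ℝ) (a b : Fin d → ℝ) :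
    (tiltMoment ε ρ X 0 t (toTorus fun i => (a i + b i) / 2) *
        Real.exp ((∑ i, ((a i + b i) / 2) ^ 2) / (2 * ε))) ^ 2 ≤
      (tiltMoment ε ρ X 0 (t - s) (toTorus a) * Real.exp ((∑ i, a i ^ 2) / (2 * ε))) *
        (tiltMoment ε ρ X 0 (t + s) (toTorus b) * Real.exp ((∑ i, b i ^ 2) / (2 * ε))) := by
  have hp := tiltMoment_zero_pos (ρ := ρ) hε hX
  have hi := fun t y => integrable_tiltMoment (ρ := ρ) hε hX 0 t y
  refine sq_le_mul_of_forall_two_mul_le (mul_pos (hp _ _) (Real.exp_pos _))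
    (mul_pos (hp _ _) (Real.exp_pos _)) (mul_pos (hp _ _) (Real.exp_pos _)).le fun l hl => ?_
  simp only [tiltMoment, ← integral_mul_const, ← integral_const_mul]
  rw [← integral_add (((hi _ _).mul_const _).const_mul _) (((hi _ _).mul_const _).const_mul _)]
  refine integral_mono (((hi _ _).mul_const _).const_mul _)
    ((((hi _ _).mul_const _).const_mul _).add (((hi _ _).mul_const _).const_mul _)) fun w => ?_
  have k0 := fun z : Torus d => gaussKernel_pos hε (w - z)
  have ka := k0 (toTorus a)
  have kb := k0 (toTorus b)
  refine two_mul_le_of_sq_le_mul (by positivity) (by positivity) hl ?_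
  have hK := gaussKernel_midpoint hε w a b
  have he : Real.exp (t * X w) ^ 2 = Real.exp ((t - s) * X w) * Real.exp ((t + s) * X w) := by
    rw [sq, ← Real.exp_add, ← Real.exp_add]; congr 1; ring
  simp only [pow_zero, one_mul]
  calc _ = Real.exp (t * X w) ^ 2 * (gaussKernel ε (w - toTorus fun i => (a i + b i) / 2) *
        Real.exp ((∑ i, ((a i + b i) / 2) ^ 2) / (2 * ε))) ^ 2 := by ring
    _ ≤ Real.exp (t * X w) ^ 2 * _ := mul_le_mul_of_nonneg_left hK (by positivity)
    _ = _ := by rw [he]; ring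

lemma tiltWeight_midpoint (hε : 0 < ε) (hX : Continuous X) (t s : ℝ) (a b : Fin d → ℝ) :
    tiltWeight ε ρ X (t - s) a * tiltWeight ε ρ X (t + s) b ≤
      tiltWeight ε ρ X t (fun i => (a i + b i) / 2) ^ 2 := by
  have hp := tiltMoment_zero_pos (ρ := ρ) hε hX
  have hm := tiltMoment_midpoint (ρ := ρ) hε hX t s a b
  rw [tiltWeight_eq hε hX, tiltWeight_eq hε hX, tiltWeight_eq hε hX,
    ← Real.mul_rpow (mul_pos (hp _ _) (Real.exp_pos _)).le (mul_pos (hp _ _) (Real.exp_pos _)).le,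
    sq (_ ^ (-ε)),
    ← Real.mul_rpow (mul_pos (hp _ _) (Real.exp_pos _)).le (mul_pos (hp _ _) (Real.exp_pos _)).le,
    ← sq]
  exact Real.rpow_le_rpow_of_nonpos (pow_pos (mul_pos (hp _ _) (Real.exp_pos _)) 2) hm
    (by linarith)

lemma continuous_toTorus_prod : Continuous fun p : ℝ × (Fin d → ℝ) => (p.1, toTorus p.2) :=
  continuous_fst.prodMk (continuous_toTorus.comp continuous_snd)

lemma continuous_tiltWeight (hε : 0 < ε) (hX : Continuous X) :
    Continuous (tiltWeight ε ρ X).uncurry := by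
  have h : Continuous fun p : ℝ × (Fin d → ℝ) => tiltMoment ε ρ X 0 p.1 (toTorus p.2) :=
    (continuous_tiltMoment hε hX 0).comp continuous_toTorus_prod
  have h' := h.rpow_const (p := -ε) fun p => Or.inl (tiltMoment_zero_pos hε hX _ _).ne'
  exact h'.mul (by fun_prop)

lemma hasDerivAt_tiltWeight (hε : 0 < ε) (hX : Continuous X) (t : ℝ) (z : Fin d → ℝ) :
    HasDerivAt (fun t => tiltWeight ε ρ X t z)
      (-ε * (tiltMean ε ρ X t (toTorus z) * tiltWeight ε ρ X t z)) t := by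
  have hp := tiltMoment_zero_pos (ρ := ρ) hε hX t (toTorus z)
  refine (((hasDerivAt_tiltMoment hε hX 0 t (toTorus z)).rpow_const
    (p := -ε) (Or.inl hp.ne')).mul_const _).congr_deriv ?_
  rw [Real.rpow_sub_one hp.ne', tiltWeight, tiltMean]
  ring

/-- The Poincaré-type inequality with the log-concave weight on the cube. -/
lemma variance_tiltMean_cube_le (hε : 0 < ε) (hX : Continuous X) (t : ℝ) :
    ∃ b : ℝ, ε * ∫ z, (tiltMean ε ρ X t (toTorus z) - b) ^ 2 * tiltWeight ε ρ X t z
        ∂(cubeMeasure d) ≤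
      ∫ z, tiltVar ε ρ X t (toTorus z) * tiltWeight ε ρ X t z ∂(cubeMeasure d) := by
  have cw := continuous_tiltWeight (ρ := ρ) hε hX
  have cm : Continuous fun p : ℝ × (Fin d → ℝ) => tiltMean ε ρ X p.1 (toTorus p.2) :=
    (continuous_tiltMean hε hX).comp continuous_toTorus_prod
  have cv : Continuous fun p : ℝ × (Fin d → ℝ) => tiltVar ε ρ X p.1 (toTorus p.2) :=
    (continuous_tiltVar hε hX).comp continuous_toTorus_prod
  have sl : ∀ {F : ℝ × (Fin d → ℝ) → ℝ}, Continuous F → ∀ t, Continuous fun z => F (t, z) :=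
    fun hF t => hF.comp (Continuous.prodMk_right t)
  set N := fun t => ∫ z, tiltWeight ε ρ X t z ∂(cubeMeasure d) with hN
  set N₁ := fun t => ∫ z, -ε * (tiltMean ε ρ X t (toTorus z) * tiltWeight ε ρ X t z)
    ∂(cubeMeasure d) with hN₁
  set N₂ := fun t => ∫ z, -ε * (tiltVar ε ρ X t (toTorus z) * tiltWeight ε ρ X t z
    + tiltMean ε ρ X t (toTorus z) *
      (-ε * (tiltMean ε ρ X t (toTorus z) * tiltWeight ε ρ X t z))) ∂(cubeMeasure d) with hN₂
  have h1 : ∀ t, HasDerivAt N (N₁ t) t := fun t =>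
    hasDerivAt_integral_of_ae_mem (isCompact_cube d) (ae_mem_cube d) (F := tiltWeight ε ρ X)
      (F' := fun t z => -ε * (tiltMean ε ρ X t (toTorus z) * tiltWeight ε ρ X t z)) cw
      (continuous_const.mul (cm.mul cw)) (hasDerivAt_tiltWeight hε hX) t
  have h2 : ∀ t, HasDerivAt N₁ (N₂ t) t := fun t => by
    refine hasDerivAt_integral_of_ae_mem (isCompact_cube d) (ae_mem_cube d)
      (F := fun t z => -ε * (tiltMean ε ρ X t (toTorus z) * tiltWeight ε ρ X t z))
      (F' := fun t z => -ε * (tiltVar ε ρ X t (toTorus z) * tiltWeight ε ρ X t z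
        + tiltMean ε ρ X t (toTorus z) *
          (-ε * (tiltMean ε ρ X t (toTorus z) * tiltWeight ε ρ X t z))))
      (continuous_const.mul (cm.mul cw))
      (continuous_const.mul ((cv.mul cw).add (cm.mul (continuous_const.mul (cm.mul cw)))))
      (fun t z => ?_) t
    exact ((hasDerivAt_tiltMean hε hX t (toTorus z)).mul
      (hasDerivAt_tiltWeight hε hX t z)).const_mul _
  have hconc : ∀ s, N (t - s) * N (t + s) ≤ N t ^ 2 := fun s =>
    prekopa_cube (sl cw _) (sl cw _) (sl cw _) (tiltWeight_pos hε hX _) (tiltWeight_pos hε hX _)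
      (tiltWeight_pos hε hX _) (tiltWeight_midpoint hε hX t s)
  -- With the identities below this reads `N(ε²S - εV) ≤ ε²A²`: the term `V` appears because the
  -- time derivative of the conditional mean is the conditional variance.
  have key := mul_le_sq_of_midpoint_logConcave h1 h2 hconc
  have iw := integrable_cubeMeasure (sl cw t)
  have im := integrable_cubeMeasure (sl (cm.mul cw) t)
  have imm := integrable_cubeMeasure (sl ((cm.pow 2).mul cw) t)
  have iv := integrable_cubeMeasure (sl (cv.mul cw) t)
  set A := ∫ z, tiltMean ε ρ X t (toTorus z) * tiltWeight ε ρ X t z ∂(cubeMeasure d) with hA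
  set S := ∫ z, tiltMean ε ρ X t (toTorus z) ^ 2 * tiltWeight ε ρ X t z ∂(cubeMeasure d) with hS
  set V := ∫ z, tiltVar ε ρ X t (toTorus z) * tiltWeight ε ρ X t z ∂(cubeMeasure d) with hV
  have e1 : N₁ t = -ε * A := integral_const_mul _ _
  have e2 : N₂ t = ε ^ 2 * S - ε * V := by
    have := integral_linear_comb imm iv iv iv (ε ^ 2) (-ε) 0 0
    rw [show ε ^ 2 * S - ε * V = ε ^ 2 * S + -ε * V + 0 * V + 0 * V by ring]
    refine Eq.trans ?_ this
    simp only [hN₂]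
    congr 1; ext z; simp only [Pi.mul_apply, Pi.pow_apply, Function.uncurry_apply_pair]; ring
  have hNpos : 0 < N t := by
    have hsup : (Function.support (tiltWeight ε ρ X t)) = Set.univ :=
      Set.eq_univ_of_forall fun z => (tiltWeight_pos hε hX t z).ne'
    simp only [hN]
    rw [integral_pos_iff_support_of_nonneg (fun z => (tiltWeight_pos hε hX t z).le) iw]
    rw [hsup, ← Set.preimage_univ (f := toTorus),
      (measurePreserving_toTorus d).measure_preimage MeasurableSet.univ.nullMeasurableSet]
    exact NeZero.pos _
  -- The mean of the conditional means under the normalized weight.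
  refine ⟨A / N t, ?_⟩
  have e3 : ∫ z, (tiltMean ε ρ X t (toTorus z) - A / N t) ^ 2 * tiltWeight ε ρ X t z
      ∂(cubeMeasure d) = S - A ^ 2 / N t := by
    have := integral_linear_comb imm im iw iw 1 (-(2 * (A / N t))) ((A / N t) ^ 2) 0
    have e : S - A ^ 2 / N t = 1 * S + -(2 * (A / N t)) * A + (A / N t) ^ 2 * N t + 0 * N t := by
      field_simp; ring
    rw [e]
    refine Eq.trans ?_ this
    congr 1; ext z; simp only [Pi.mul_apply, Pi.pow_apply, Function.uncurry_apply_pair]; ring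
  rw [e3]
  rw [e1, e2] at key
  have h3 : ε * (N t * (ε * (S - A ^ 2 / N t))) ≤ ε * (N t * V) := by
    have : N t * (ε * (S - A ^ 2 / N t)) = ε * (N t * S - A ^ 2) := by field_simp
    rw [this]
    nlinarith [key]
  exact le_of_mul_le_mul_left (le_of_mul_le_mul_left h3 hε) hNpos

end Weight

/-! ### Density measures -/

section Density

variable {m M : ℝ} {n : Torus d → ℝ}

lemma IsDensityIn.integral_densityMeasure (hn : IsDensityIn m M n) (hm : 0 < m)
    (f : Torus d → ℝ) : ∫ x, f x ∂(densityMeasure n) = ∫ x, n x * f x := by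
  rw [densityMeasure, integral_withDensity_eq_integral_toReal_smul
    hn.measurable.ennreal_ofReal (by simp)]
  congr 1; ext x
  rw [ENNReal.toReal_ofReal (hm.le.trans (hn.mem_Icc x).1), smul_eq_mul]

lemma IsDensityIn.integrable_mul (hn : IsDensityIn m M n) (hm : 0 < m) {f : Torus d → ℝ}
    (hf : Continuous f) : Integrable (fun x => n x * f x) :=
  (integrable_of_continuous hf).bdd_mul (c := M) hn.measurable.aestronglyMeasurable
    (Filter.Eventually.of_forall fun x => by
      rw [Real.norm_of_nonneg (hm.le.trans (hn.mem_Icc x).1)]; exact (hn.mem_Icc x).2)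

lemma IsDensityIn.isProbabilityMeasure (hn : IsDensityIn m M n) (hm : 0 < m) :
    IsProbabilityMeasure (densityMeasure n) := by
  constructor
  rw [densityMeasure, withDensity_apply _ MeasurableSet.univ, Measure.restrict_univ,
    ← ofReal_integral_eq_lintegral_ofReal, hn.integral_eq_one, ENNReal.ofReal_one]
  · simpa using hn.integrable_mul hm (continuous_const (y := (1 : ℝ)))
  · exact Filter.Eventually.of_forall fun x => hm.le.trans (hn.mem_Icc x).1

lemma IsDensityIn.integral_le (hn : IsDensityIn m M n) (hm : 0 < m) {f : Torus d → ℝ}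
    (hf : Continuous f) (f0 : ∀ x, 0 ≤ f x) :
    ∫ x, f x ∂(densityMeasure n) ≤ M * ∫ x, f x := by
  rw [hn.integral_densityMeasure hm, ← integral_const_mul]
  exact integral_mono (hn.integrable_mul hm hf) ((integrable_of_continuous hf).const_mul _)
    fun x => mul_le_mul_of_nonneg_right (hn.mem_Icc x).2 (f0 x)

lemma IsDensityIn.le_integral (hn : IsDensityIn m M n) (hm : 0 < m) {f : Torus d → ℝ}
    (hf : Continuous f) (f0 : ∀ x, 0 ≤ f x) :
    m * ∫ x, f x ≤ ∫ x, f x ∂(densityMeasure n) := by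
  rw [hn.integral_densityMeasure hm, ← integral_const_mul]
  exact integral_mono ((integrable_of_continuous hf).const_mul _) (hn.integrable_mul hm hf)
    fun x => mul_le_mul_of_nonneg_right (hn.mem_Icc x).1 (f0 x)

end Density

/-! ### The Poincaré-type inequality on the torus -/

section Poincare

variable {ε : ℝ} {ρ : Measure (Torus d)} [IsFiniteMeasure ρ] {X : Torus d → ℝ}

lemma tiltMoment_zero_le_mul (hε : 0 < ε) (hX : Continuous X) (t : ℝ) (x y : Torus d) :
    tiltMoment ε ρ X 0 t x ≤ Real.exp (d * (π ^ 2 / (2 * ε))) * tiltMoment ε ρ X 0 t y := by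
  have hi := fun y => integrable_tiltMoment (ρ := ρ) hε hX 0 t y
  rw [tiltMoment, tiltMoment, ← integral_const_mul]
  refine integral_mono (hi x) ((hi y).const_mul _) fun w => ?_
  have := mul_le_mul_of_nonneg_left (gaussKernel_le_mul hε (w - x) (w - y))
    (Real.exp_pos (t * X w)).le
  simp only [pow_zero, one_mul]
  linarith

variable [NeZero ρ]

/-- The power `-ε` cancels the `1/ε` in the Harnack exponent, which makes the comparison constant
independent of `ε`. -/
lemma tiltMoment_rpow_le_mul (hε : 0 < ε) (hX : Continuous X) (t : ℝ) (x y : Torus d) :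
    tiltMoment ε ρ X 0 t x ^ (-ε) ≤
      Real.exp (d * (π ^ 2 / 2)) * tiltMoment ε ρ X 0 t y ^ (-ε) := by
  have hp := tiltMoment_zero_pos (ρ := ρ) hε hX t
  have h := Real.rpow_le_rpow_of_nonpos (hp y) (tiltMoment_zero_le_mul hε hX t y x)
    (by linarith : -ε ≤ 0)
  rw [Real.mul_rpow (Real.exp_pos _).le (hp x).le, ← Real.exp_mul] at h
  have e : (d : ℝ) * (π ^ 2 / (2 * ε)) * -ε = -(d * (π ^ 2 / 2)) := by field_simp
  rw [e, Real.exp_neg, inv_mul_le_iff₀ (Real.exp_pos _)] at h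
  exact h

lemma sum_sq_le_of_mem_cube {z : Fin d → ℝ}
    (hz : z ∈ Set.univ.pi fun _ : Fin d => Set.Icc (0 : ℝ) (2 * π)) :
    ∑ i, z i ^ 2 ≤ d * (4 * π ^ 2) := by
  calc ∑ i, z i ^ 2 ≤ ∑ _i : Fin d, (4 * π ^ 2) := Finset.sum_le_sum fun i _ => by
        have := hz i (Set.mem_univ _)
        nlinarith [this.1, this.2, pow_le_pow_left₀ this.1 this.2 2]
    _ = _ := by simp

/-- A Poincaré-type inequality for the conditional means, uniform in the tilt. -/
theorem variance_tiltMean_le {m M : ℝ} {n : Torus d → ℝ} (hn : IsDensityIn m M n) (hm : 0 < m)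
    (hM : 0 < M) (hε : 0 < ε) (hX : Continuous X) (t : ℝ) :
    ∃ b : ℝ, ∫ y, (tiltMean ε ρ X t y - b) ^ 2 ∂(densityMeasure n) ≤
      M / (m * ε) * Real.exp (8 * π ^ 2 * d) * ∫ y, tiltVar ε ρ X t y ∂(densityMeasure n) := by
  obtain ⟨b, hb⟩ := variance_tiltMean_cube_le (ρ := ρ) hε hX t
  refine ⟨b, ?_⟩
  have cm : Continuous (tiltMean ε ρ X t) :=
    (continuous_tiltMean hε hX).comp (Continuous.prodMk_right t)
  have cv : Continuous (tiltVar ε ρ X t) :=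
    (continuous_tiltVar hε hX).comp (Continuous.prodMk_right t)
  have cw : Continuous (tiltWeight ε ρ X t) :=
    (continuous_tiltWeight hε hX).comp (Continuous.prodMk_right t)
  have c1 : Continuous fun y => (tiltMean ε ρ X t y - b) ^ 2 := (cm.sub continuous_const).pow 2
  have v0 := tiltVar_nonneg (ρ := ρ) hε hX t
  -- Reference value for the weight: `α` bounds the variation of the power of the tilted mass, and
  -- `β` the loss from the Gaussian factor, as `‖z‖² ≤ 4π²d` on the cube.
  set q := tiltMoment ε ρ X 0 t 0 ^ (-ε) with hq
  have hq0 : 0 < q := Real.rpow_pos_of_pos (tiltMoment_zero_pos hε hX t 0) _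
  set α := Real.exp (d * (π ^ 2 / 2)) with hα
  set β := Real.exp (d * (2 * π ^ 2)) with hβ
  have α0 : 0 < α := Real.exp_pos _
  have β0 : 0 < β := Real.exp_pos _
  have up : ∀ z, tiltWeight ε ρ X t z ≤ α * q := fun z => by
    rw [tiltWeight, ← mul_one (α * q)]
    refine mul_le_mul (tiltMoment_rpow_le_mul hε hX t _ _) ?_ (Real.exp_pos _).le (by positivity)
    have : 0 ≤ ∑ i, z i ^ 2 := Finset.sum_nonneg fun i _ => sq_nonneg _
    exact Real.exp_le_one_iff.2 (by linarith)
  have lo : ∀ z ∈ Set.univ.pi fun _ : Fin d => Set.Icc (0 : ℝ) (2 * π),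
      q ≤ α * β * tiltWeight ε ρ X t z := fun z hz => by
    have h1 := tiltMoment_rpow_le_mul (ρ := ρ) hε hX t 0 (toTorus z)
    have h2 : 1 ≤ β * Real.exp (-(∑ i, z i ^ 2) / 2) := by
      rw [hβ, ← Real.exp_add]
      exact Real.one_le_exp (by linarith [sum_sq_le_of_mem_cube hz])
    rw [tiltWeight]
    calc q = q * 1 := (mul_one _).symm
      _ ≤ (α * tiltMoment ε ρ X 0 t (toTorus z) ^ (-ε)) * (β * Real.exp (-(∑ i, z i ^ 2) / 2)) :=
        mul_le_mul h1 h2 zero_le_one (hq0.le.trans h1)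
      _ = _ := by ring
  have s1 : q * ∫ y, (tiltMean ε ρ X t y - b) ^ 2 ≤
      α * β * ∫ z, (tiltMean ε ρ X t (toTorus z) - b) ^ 2 * tiltWeight ε ρ X t z
        ∂(cubeMeasure d) := by
    rw [integral_torus_eq c1, ← integral_const_mul, ← integral_const_mul]
    refine integral_mono_ae ((integrable_cubeMeasure (c1.comp continuous_toTorus)).const_mul _)
      ((integrable_cubeMeasure ((c1.comp continuous_toTorus).mul cw)).const_mul _) ?_
    filter_upwards [ae_mem_cube d] with z hz
    have := mul_le_mul_of_nonneg_left (lo z hz) (sq_nonneg (tiltMean ε ρ X t (toTorus z) - b))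
    linarith
  have s2 : ∫ z, tiltVar ε ρ X t (toTorus z) * tiltWeight ε ρ X t z ∂(cubeMeasure d) ≤
      α * q * ∫ y, tiltVar ε ρ X t y := by
    rw [integral_torus_eq cv, ← integral_const_mul]
    refine integral_mono (integrable_cubeMeasure ((cv.comp continuous_toTorus).mul cw))
      ((integrable_cubeMeasure (cv.comp continuous_toTorus)).const_mul _) fun z => ?_
    have := mul_le_mul_of_nonneg_left (up z) (v0 (toTorus z))
    linarith
  have s3 := hn.integral_le hm c1 fun y => sq_nonneg _
  have s4 := hn.le_integral hm cv v0
  set A := ∫ y, (tiltMean ε ρ X t y - b) ^ 2 with hA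
  set B := ∫ z, (tiltMean ε ρ X t (toTorus z) - b) ^ 2 * tiltWeight ε ρ X t z ∂(cubeMeasure d)
  set V := ∫ y, tiltVar ε ρ X t y with hV
  have V0 : 0 ≤ V := integral_nonneg v0
  -- The accumulated constant is `exp(3π²d)`, which lies below the stated one.
  have hγ : α * β * α ≤ Real.exp (8 * π ^ 2 * d) := by
    rw [hα, hβ, ← Real.exp_add, ← Real.exp_add]
    refine Real.exp_le_exp.2 ?_
    have : 0 ≤ (d : ℝ) * π ^ 2 := by positivity
    linarith
  have s5 : ε * A ≤ Real.exp (8 * π ^ 2 * d) * V := by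
    have h1 : q * (ε * A) ≤ q * (α * β * α * V) := by
      calc q * (ε * A) = ε * (q * A) := by ring
        _ ≤ ε * (α * β * B) := mul_le_mul_of_nonneg_left s1 hε.le
        _ = α * β * (ε * B) := by ring
        _ ≤ α * β * (α * q * V) := mul_le_mul_of_nonneg_left (hb.trans s2) (by positivity)
        _ = _ := by ring
    exact (le_of_mul_le_mul_left h1 hq0).trans (mul_le_mul_of_nonneg_right hγ V0)
  calc _ ≤ M * A := s3
    _ = M / (m * ε) * (m * (ε * A)) := by field_simp
    _ ≤ M / (m * ε) * (m * (Real.exp (8 * π ^ 2 * d) * V)) := by gcongr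
    _ = M / (m * ε) * Real.exp (8 * π ^ 2 * d) * (m * V) := by ring
    _ ≤ _ := by gcongr

end Poincare

/-! ### From differential to integrated stability -/

/-- Integrate the hypothesis over `[0, t]`, then over `[0, 1]`. The remainder `Λ t - u 0 * t - Λ 0`
is nondecreasing by convexity and so is at most its value `D` at `1`. The result is `V/2 ≤ A D + 2 s
D`. -/
lemma le_of_differential_inequality {Λ u a : ℝ → ℝ} (h1 : ∀ t, HasDerivAt Λ (u t) t)
    (h2 : ∀ t, HasDerivAt u (a t) t) (a0 : ∀ t, 0 ≤ a t) {V A s : ℝ} (hs : 0 ≤ s)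
    (h : ∀ t, 0 ≤ t → V ≤ A * a t + 2 * s * (u t - u 0)) :
    V ≤ (2 * A + 4 * s) * (Λ 1 - Λ 0 - u 0) := by
  have mono : ∀ {f f' : ℝ → ℝ}, (∀ t, HasDerivAt f (f' t) t) →
      (∀ t ∈ Set.Icc (0 : ℝ) 1, 0 ≤ f' t) → ∀ t ∈ Set.Icc (0 : ℝ) 1, ∀ r ∈ Set.Icc (0 : ℝ) 1,
      t ≤ r → f t ≤ f r := fun {f f'} hf hf' => by
    have := monotoneOn_of_deriv_nonneg (f := f) (convex_Icc (0 : ℝ) 1)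
      (fun t _ => (hf t).continuousAt.continuousWithinAt)
      (fun t _ => (hf t).differentiableAt.differentiableWithinAt)
      (fun t ht => by rw [(hf t).deriv]; exact hf' t (interior_subset ht))
    exact this
  have z0 : (0 : ℝ) ∈ Set.Icc (0 : ℝ) 1 := by simp
  have z1 : (1 : ℝ) ∈ Set.Icc (0 : ℝ) 1 := by simp
  have umono : ∀ t, 0 ≤ t → u 0 ≤ u t := fun t ht =>
    monotone_of_deriv_nonneg (fun t => (h2 t).differentiableAt)
      (fun t => by rw [(h2 t).deriv]; exact a0 t) ht
  set D := Λ 1 - Λ 0 - u 0 with hD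
  have hΛ : ∀ t ∈ Set.Icc (0 : ℝ) 1, Λ t - u 0 * t - Λ 0 ≤ D := fun t ht => by
    have := mono (f := fun t => Λ t - u 0 * t) (f' := fun t => u t - u 0)
      (fun t => ((h1 t).sub ((hasDerivAt_id t).const_mul (u 0))).congr_deriv (by simp))
      (fun t ht => sub_nonneg.2 (umono t ht.1)) t ht 1 z1 ht.2
    simp only [mul_one] at this
    linarith
  have step1 : ∀ t ∈ Set.Icc (0 : ℝ) 1,
      V * t ≤ A * (u t - u 0) + 2 * s * (Λ t - u 0 * t - Λ 0) := fun t ht => by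
    have := mono (f := fun t => A * u t + 2 * s * (Λ t - u 0 * t) - V * t)
      (f' := fun t => A * a t + 2 * s * (u t - u 0) - V)
      (fun t => ((((h2 t).const_mul A).add (((h1 t).sub
          ((hasDerivAt_id t).const_mul (u 0))).const_mul (2 * s))).sub
          ((hasDerivAt_id t).const_mul V)).congr_deriv (by simp))
      (fun t ht => sub_nonneg.2 (h t ht.1)) 0 z0 t ht ht.1
    simp only [mul_zero, sub_zero] at this
    linarith
  have step2 := mono (f := fun t => A * (Λ t - u 0 * t) + 2 * s * D * t - V * (t ^ 2 / 2))
    (f' := fun t => A * (u t - u 0) + 2 * s * D - V * t)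
    (fun t => by
      have hsq : HasDerivAt (fun t : ℝ => t ^ 2 / 2) t t := by
        simpa using (hasDerivAt_pow 2 t).div_const 2
      exact (((((h1 t).sub ((hasDerivAt_id t).const_mul (u 0))).const_mul A).add
        ((hasDerivAt_id t).const_mul (2 * s * D))).sub (hsq.const_mul V)).congr_deriv (by simp))
    (fun t ht => by
      have := step1 t ht
      have := mul_le_mul_of_nonneg_left (hΛ t ht) (by linarith : 0 ≤ 2 * s)
      linarith) 0 z0 1 z1 zero_le_one
  norm_num at step2
  rw [hD] at step2 ⊢
  linarith

section Core

variable {ε : ℝ} {ρ : Measure (Torus d)} [IsFiniteMeasure ρ] [NeZero ρ] {X : Torus d → ℝ}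

/-- The integrated stability inequality for the averaged log-moment generating function. -/
theorem second_moment_sub_sq_le {ν : Measure (Torus d)} [IsProbabilityMeasure ν] (hε : 0 < ε)
    (hX : Continuous X) {B s : ℝ} (hs : 0 ≤ s) (hosc : ∀ w w', X w - X w' ≤ s)
    (hB : ∀ t, ∃ b : ℝ, ∫ y, (tiltMean ε ρ X t y - b) ^ 2 ∂ν ≤ B * ∫ y, tiltVar ε ρ X t y ∂ν) :
    (∫ y, tiltSecond ε ρ X 0 y ∂ν) - (∫ y, tiltMean ε ρ X 0 y ∂ν) ^ 2 ≤
      (2 * (1 + B) + 4 * s) * ((∫ y, Real.log (tiltMoment ε ρ X 0 1 y) ∂ν)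
        - (∫ y, Real.log (tiltMoment ε ρ X 0 0 y) ∂ν) - ∫ y, tiltMean ε ρ X 0 y ∂ν) := by
  have cM := continuous_tiltMoment (ρ := ρ) hε hX 0
  have cm := continuous_tiltMean (ρ := ρ) hε hX
  have cs := continuous_tiltSecond (ρ := ρ) hε hX
  have cv := continuous_tiltVar (ρ := ρ) hε hX
  have sl : ∀ {F : ℝ → Torus d → ℝ}, Continuous F.uncurry → ∀ t, Continuous (F t) :=
    fun hF t => hF.comp (Continuous.prodMk_right t)
  set u := fun t => ∫ y, tiltMean ε ρ X t y ∂ν with hu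
  refine le_of_differential_inequality (Λ := fun t => ∫ y, Real.log (tiltMoment ε ρ X 0 t y) ∂ν)
    (u := u) (a := fun t => ∫ y, tiltVar ε ρ X t y ∂ν) (fun t => ?_) (fun t => ?_)
    (fun t => integral_nonneg (tiltVar_nonneg hε hX t)) hs (fun t ht => ?_)
  · refine hasDerivAt_integral_of_ae_mem isCompact_univ (by simp) ?_ cm
      (hasDerivAt_log_tiltMoment hε hX) t
    exact cM.log fun p => (tiltMoment_zero_pos hε hX _ _).ne'
  · exact hasDerivAt_integral_of_ae_mem isCompact_univ (by simp) cm cv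
      (hasDerivAt_tiltMean hε hX) t
  · have im := fun t => integrable_of_continuous (μ := ν) (sl cm t)
    have im2 := fun t => integrable_of_continuous (μ := ν) ((sl cm t).pow 2)
    have is := fun t => integrable_of_continuous (μ := ν) (sl cs t)
    have iv := fun t => integrable_of_continuous (μ := ν) (sl cv t)
    have i1 : Integrable (fun _ : Torus d => (1 : ℝ)) ν := integrable_const 1
    have sq_dev : ∀ c, ∫ y, (tiltMean ε ρ X t y - c) ^ 2 ∂ν
        = (∫ y, tiltMean ε ρ X t y ^ 2 ∂ν) - 2 * c * u t + c ^ 2 := fun c => by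
      have := integral_linear_comb (im2 t) (im t) i1 i1 1 (-(2 * c)) (c ^ 2) 0
      rw [integral_const, probReal_univ, one_smul] at this
      rw [show (∫ y, tiltMean ε ρ X t y ^ 2 ∂ν) - 2 * c * u t + c ^ 2 =
        1 * (∫ y, tiltMean ε ρ X t y ^ 2 ∂ν) + -(2 * c) * u t + c ^ 2 * 1 + 0 * 1 by ring]
      refine Eq.trans ?_ this
      congr 1; ext y; simp only [Pi.pow_apply]; ring
    obtain ⟨b, hb⟩ := hB t
    have hvar : ∫ y, tiltVar ε ρ X t y ∂ν =
        (∫ y, tiltSecond ε ρ X t y ∂ν) - ∫ y, tiltMean ε ρ X t y ^ 2 ∂ν :=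
      integral_sub (is t) (im2 t)
    -- `u t` is an average of averages of `X`, so it lies in the range where `c = u t` is admissible
    -- in the correlation inequality.
    have hmem : ∀ w, |X w - u t| ≤ s := fun w => by
      have h1 : ∀ y, tiltMean ε ρ X t y ∈ Set.Icc (X w - s) (X w + s) :=
        tiltMean_mem_Icc hε hX (fun w' => ⟨by linarith [hosc w w'], by linarith [hosc w' w]⟩) t
      have h2 : X w - s ≤ u t := by
        have := integral_mono (μ := ν) (integrable_const (X w - s)) (im t) fun y => (h1 y).1
        simpa using this
      have h3 : u t ≤ X w + s := by
        have := integral_mono (μ := ν) (im t) (integrable_const (X w + s)) fun y => (h1 y).2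
        simpa using this
      exact abs_le.2 ⟨by linarith, by linarith⟩
    have hmono : (∫ y, tiltSecond ε ρ X 0 y ∂ν) + (2 * s - 2 * u t) * u 0 ≤
        (∫ y, tiltSecond ε ρ X t y ∂ν) + (2 * s - 2 * u t) * u t := by
      have e : ∀ k r, (∫ y, tiltSecond ε ρ X r y ∂ν) + k * u r =
          ∫ y, (tiltSecond ε ρ X r y + k * tiltMean ε ρ X r y) ∂ν := fun k r => by
        rw [integral_add (is r) ((im r).const_mul _), integral_const_mul]
      rw [e, e]
      exact integral_mono ((is 0).add ((im 0).const_mul _)) ((is t).add ((im t).const_mul _))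
        fun y => tiltSecond_add_mono hε hX ht hmem y
    rw [sq_dev] at hb
    -- Total variance at time `t`: `∫ m² - (u t)²`, with `m` the conditional mean, is at most the
    -- squared deviation from any `b`, hence at most `B a(t)`. Replacing time `t` by `0` costs `2s(u
    -- t - u 0) - (u t - u 0)²`.
    nlinarith [sq_nonneg (u t - u 0), sq_nonneg (u t - b)]

end Core

/-! ### First-order optimality of Schrödinger potentials -/

lemma exp_sub_cost_div {ε : ℝ} (hε : 0 < ε) (a : ℝ) (x y : Torus d) :
    Real.exp ((a - cost ε x y) / ε) = Real.exp (a / ε) * gaussKernel ε (x - y) := by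
  rw [cost, show (a - -ε * Real.log (gaussKernel ε (x - y))) / ε
    = a / ε + Real.log (gaussKernel ε (x - y)) by field_simp; ring, Real.exp_add,
    Real.exp_log (gaussKernel_pos hε _)]

lemma gibbsDensity_eq {ε : ℝ} (hε : 0 < ε) (φ ψ : Torus d → ℝ) (p : Torus d × Torus d) :
    gibbsDensity ε φ ψ p =
      Real.exp (φ p.1 / ε) * Real.exp (ψ p.2 / ε) * gaussKernel ε (p.1 - p.2) := by
  rw [gibbsDensity, exp_sub_cost_div hε, add_div, Real.exp_add]

/-- A linear term dominated by a quadratic one near `0` must vanish. This yields the first-order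
condition without differentiating the dual objective. -/
lemma eq_zero_of_mul_le_mul_sq {x K δ : ℝ} (hδ : 0 < δ)
    (h : ∀ s, |s| ≤ δ → s * x ≤ K * s ^ 2) : x = 0 := by
  have hK : 0 ≤ K := by
    have h1 := h δ (by rw [abs_of_pos hδ])
    have h2 := h (-δ) (by rw [abs_neg, abs_of_pos hδ])
    nlinarith [pow_pos hδ 2]
  by_contra hx
  have hx0 : 0 < |x| := abs_pos.2 hx
  set r := min δ (|x| / (2 * (K + 1))) with hr
  have hr0 : 0 < r := lt_min hδ (by positivity)
  have key : r * |x| ≤ K * r ^ 2 := by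
    rcases le_total 0 x with h0 | h0
    · have := h r (by rw [abs_of_pos hr0]; exact min_le_left _ _)
      rwa [abs_of_nonneg h0]
    · have := h (-r) (by rw [abs_neg, abs_of_pos hr0]; exact min_le_left _ _)
      rw [abs_of_nonpos h0]; linarith
  have h2 : r * (2 * (K + 1)) ≤ |x| := (le_div_iff₀ (by positivity)).1 (min_le_right _ _)
  nlinarith [mul_nonneg hK (sq_nonneg r), mul_le_mul_of_nonneg_left h2 hr0.le, pow_pos hr0 2]

section Optimality

variable {ε : ℝ} {μ ν : Measure (Torus d)} {φ ψ : Torus d → ℝ}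

/-- The measure `exp(φ / ε) dμ`. -/
def expMeasure (ε : ℝ) (μ : Measure (Torus d)) (φ : Torus d → ℝ) : Measure (Torus d) :=
  μ.withDensity fun x => ENNReal.ofReal (Real.exp (φ x / ε))

lemma integral_expMeasure (hφ : AEMeasurable φ μ) (f : Torus d → ℝ) :
    ∫ x, f x ∂(expMeasure ε μ φ) = ∫ x, Real.exp (φ x / ε) * f x ∂μ := by
  rw [expMeasure, integral_withDensity_eq_integral_toReal_smul₀
    (hφ.div_const ε).exp.ennreal_ofReal (by simp)]
  congr 1; ext x
  rw [ENNReal.toReal_ofReal (Real.exp_pos _).le, smul_eq_mul]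

lemma neZero_expMeasure [NeZero μ] (hφ : AEMeasurable φ μ) : NeZero (expMeasure ε μ φ) := by
  refine ⟨fun h0 => ?_⟩
  rw [expMeasure, withDensity_eq_zero_iff
    (hφ.div_const ε).exp.ennreal_ofReal] at h0
  obtain ⟨x, hx⟩ := h0.exists
  simp only [Pi.zero_apply, ENNReal.ofReal_eq_zero] at hx
  exact absurd hx (not_le.2 (Real.exp_pos _))

/-- Perturbing the potential linearly in `t` becomes an exponential tilt, so the functional turns
into an averaged log-moment generating function. -/
lemma transform_add_eq (hε : 0 < ε) (hφ : AEMeasurable φ μ) (X : Torus d → ℝ) (t : ℝ)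
    (y : Torus d) : transform ε μ (fun x => φ x + ε * (t * X x)) y =
      -ε * Real.log (tiltMoment ε (expMeasure ε μ φ) X 0 t y) := by
  rw [transform, tiltMoment, integral_expMeasure hφ]
  congr 3; ext w
  rw [exp_sub_cost_div hε, add_div, Real.exp_add, mul_div_cancel_left₀ _ hε.ne']
  ring

variable [IsProbabilityMeasure μ] [IsProbabilityMeasure ν]

/-- Weak form of the marginal constraints on the Gibbs plan. The bounded perturbations `φ + sχ`, `ψ
+ sη` stay admissible, and a second-order expansion of the exponential compares their objective with
the maximum. -/
lemma IsSchrodingerPotentials.integral_add_integral_eq (hε : 0 < ε)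
    (h : IsSchrodingerPotentials ε μ ν φ ψ) {χ η : Torus d → ℝ} (hχ : Measurable χ)
    (hη : Measurable η) {C : ℝ} (hχC : ∀ x, |χ x| ≤ C) (hηC : ∀ x, |η x| ≤ C) :
    ∫ x, χ x ∂μ + ∫ y, η y ∂ν =
      ∫ p, (χ p.1 + η p.2) * gibbsDensity ε φ ψ p ∂(μ.prod ν) := by
  have iχ : Integrable χ μ := Integrable.of_bound hχ.aestronglyMeasurable C
    (Filter.Eventually.of_forall hχC)
  have iη : Integrable η ν := Integrable.of_bound hη.aestronglyMeasurable C
    (Filter.Eventually.of_forall hηC)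
  have iγ := h.finite.integrable_gibbs
  have γ0 : ∀ p, 0 < gibbsDensity ε φ ψ p := fun p => Real.exp_pos _
  have C0 : 0 ≤ C := (abs_nonneg _).trans (hχC 0)
  set g : Torus d × Torus d → ℝ := fun p => χ p.1 + η p.2 with hg
  have mg : Measurable g := (hχ.comp measurable_fst).add (hη.comp measurable_snd)
  have gC : ∀ p, |g p| ≤ 2 * C := fun p => by
    have := abs_add_le (χ p.1) (η p.2)
    linarith [hχC p.1, hηC p.2]
  have igγ : Integrable (fun p => g p * gibbsDensity ε φ ψ p) (μ.prod ν) :=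
    iγ.bdd_mul mg.aestronglyMeasurable (Filter.Eventually.of_forall gC)
  have hγ' : ∀ s p, gibbsDensity ε (fun x => φ x + s * χ x) (fun y => ψ y + s * η y) p
      = Real.exp (s * g p / ε) * gibbsDensity ε φ ψ p := fun s p => by
    rw [gibbsDensity, gibbsDensity, ← Real.exp_add, hg]
    congr 1; ring
  have iγ' : ∀ s, Integrable (fun p => Real.exp (s * g p / ε) * gibbsDensity ε φ ψ p)
      (μ.prod ν) := fun s => by
    refine iγ.bdd_mul (c := Real.exp (|s| * (2 * C) / ε))
      (by fun_prop) (Filter.Eventually.of_forall fun p => ?_)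
    rw [Real.norm_of_nonneg (Real.exp_pos _).le]
    refine Real.exp_le_exp.2 (div_le_div_of_nonneg_right ?_ hε.le)
    calc s * g p ≤ |s * g p| := le_abs_self _
      _ = |s| * |g p| := abs_mul _ _
      _ ≤ _ := by gcongr; exact gC p
  -- The radius `ε / (2C + 1)` keeps the exponent within `[-1, 1]`, where `exp v ≤ 1 + v + v²`; the
  -- `+ 1` covers `C = 0`. `K` is the coefficient of the quadratic remainder.
  refine sub_eq_zero.1 (eq_zero_of_mul_le_mul_sq (δ := ε / (2 * C + 1))
    (K := (2 * C) ^ 2 / ε * ∫ p, gibbsDensity ε φ ψ p ∂(μ.prod ν)) (by positivity) fun s hs => ?_)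
  have hfin : DualFinite ε μ ν (fun x => φ x + s * χ x) (fun y => ψ y + s * η y) :=
    ⟨h.finite.integrable_left.add (iχ.const_mul s), h.finite.integrable_right.add (iη.const_mul s),
      by rw [funext (hγ' s)]; exact iγ' s⟩
  have hmax := h.isMax _ _ hfin
  rw [dualObjective, dualObjective, integral_add h.finite.integrable_left (iχ.const_mul s),
    integral_add h.finite.integrable_right (iη.const_mul s), integral_const_mul,
    integral_const_mul, funext (hγ' s)] at hmax
  have hle : ∫ p, Real.exp (s * g p / ε) * gibbsDensity ε φ ψ p ∂(μ.prod ν) ≤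
      1 * ∫ p, gibbsDensity ε φ ψ p ∂(μ.prod ν)
        + s / ε * ∫ p, g p * gibbsDensity ε φ ψ p ∂(μ.prod ν)
        + (s * (2 * C) / ε) ^ 2 * ∫ p, gibbsDensity ε φ ψ p ∂(μ.prod ν)
        + 0 * ∫ p, gibbsDensity ε φ ψ p ∂(μ.prod ν) := by
    rw [← integral_linear_comb iγ igγ iγ iγ]
    refine integral_mono (iγ' s) ((((iγ.const_mul _).add (igγ.const_mul _)).add
      (iγ.const_mul _)).add (iγ.const_mul _)) fun p => ?_
    have hv : |s * g p / ε| ≤ |s| * (2 * C) / ε := by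
      rw [abs_div, abs_mul, abs_of_pos hε]
      gcongr
      exact gC p
    have hv1 : |s * g p / ε| ≤ 1 := by
      refine hv.trans ((div_le_one hε).2 ?_)
      calc |s| * (2 * C) ≤ ε / (2 * C + 1) * (2 * C + 1) := by gcongr; linarith
        _ = ε := by field_simp
    have h1 := (abs_le.1 (Real.abs_exp_sub_one_sub_id_le hv1)).2
    have h2 : (s * g p / ε) ^ 2 ≤ (s * (2 * C) / ε) ^ 2 := by
      refine sq_le_sq.2 (hv.trans (le_of_eq ?_))
      rw [abs_div, abs_mul, abs_of_pos hε, abs_of_nonneg (by positivity : 0 ≤ 2 * C)]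
    have h3 : Real.exp (s * g p / ε) ≤ 1 + s * g p / ε + (s * (2 * C) / ε) ^ 2 := by linarith
    have := mul_le_mul_of_nonneg_right h3 (γ0 p).le
    refine this.trans (le_of_eq ?_)
    ring
  have hle' := mul_le_mul_of_nonneg_left hle hε.le
  have e : ε * (1 * ∫ p, gibbsDensity ε φ ψ p ∂(μ.prod ν)
        + s / ε * ∫ p, g p * gibbsDensity ε φ ψ p ∂(μ.prod ν)
        + (s * (2 * C) / ε) ^ 2 * ∫ p, gibbsDensity ε φ ψ p ∂(μ.prod ν)
        + 0 * ∫ p, gibbsDensity ε φ ψ p ∂(μ.prod ν)) =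
      ε * ∫ p, gibbsDensity ε φ ψ p ∂(μ.prod ν) + s * ∫ p, g p * gibbsDensity ε φ ψ p ∂(μ.prod ν)
      + ((2 * C) ^ 2 / ε * ∫ p, gibbsDensity ε φ ψ p ∂(μ.prod ν)) * s ^ 2 := by
    field_simp
    ring
  rw [e] at hle'
  linarith

/-- Fubini supplies one `y` whose slice of the Gibbs density is integrable. The kernel is bounded
away from zero on the compact torus and can be divided out. -/
lemma IsSchrodingerPotentials.integrable_exp (hε : 0 < ε)
    (h : IsSchrodingerPotentials ε μ ν φ ψ) : Integrable (fun x => Real.exp (φ x / ε)) μ := by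
  obtain ⟨y, hy⟩ := h.finite.integrable_gibbs.prod_left_ae.exists
  have hk := continuous_gaussKernel (d := d) hε
  have hc : Continuous fun x : Torus d => (gaussKernel ε (x - y))⁻¹ * Real.exp (-(ψ y / ε)) :=
    ((hk.comp (continuous_id.sub continuous_const)).inv₀
      fun x => (gaussKernel_pos hε _).ne').mul continuous_const
  obtain ⟨C, hC⟩ := isCompact_univ.exists_bound_of_continuousOn hc.continuousOn
  refine (hy.bdd_mul hc.aestronglyMeasurable
    (Filter.Eventually.of_forall fun x => hC x (Set.mem_univ x))).congr
      (Filter.Eventually.of_forall fun x => ?_)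
  have := (gaussKernel_pos hε (x - y)).ne'
  simp only [gibbsDensity_eq hε, Real.exp_neg]
  field_simp

lemma IsSchrodingerPotentials.isFiniteMeasure_expMeasure (hε : 0 < ε)
    (h : IsSchrodingerPotentials ε μ ν φ ψ) : IsFiniteMeasure (expMeasure ε μ φ) :=
  isFiniteMeasure_withDensity_ofReal (h.integrable_exp hε).2

/-- Averaging conditional means of a continuous function over the second marginal of the
Schrödinger plan gives its mean for the first marginal. -/
lemma IsSchrodingerPotentials.integral_conditional (hε : 0 < ε)
    (h : IsSchrodingerPotentials ε μ ν φ ψ) {f : Torus d → ℝ} (hf : Continuous f) :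
    ∫ y, (∫ w, f w * gaussKernel ε (w - y) ∂(expMeasure ε μ φ)) /
      (∫ w, gaussKernel ε (w - y) ∂(expMeasure ε μ φ)) ∂ν = ∫ x, f x ∂μ := by
  have hφ := h.finite.integrable_left.aemeasurable
  have iγ := h.finite.integrable_gibbs
  have slice : ∀ (g : Torus d → ℝ) (y : Torus d), ∫ x, g x * gibbsDensity ε φ ψ (x, y) ∂μ =
      Real.exp (ψ y / ε) * ∫ w, g w * gaussKernel ε (w - y) ∂(expMeasure ε μ φ) := fun g y => by
    rw [integral_expMeasure hφ, ← integral_const_mul]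
    congr 1; ext x
    rw [gibbsDensity_eq hε]; ring
  -- The Gibbs plan has second marginal `ν`, tested on indicators in the second variable. Hence
  -- `exp(ψ/ε)` is `ν`-a.e. the normalizing factor of the conditional law of the first variable.
  have marg : (fun y => Real.exp (ψ y / ε) * ∫ w, gaussKernel ε (w - y) ∂(expMeasure ε μ φ))
      =ᵐ[ν] fun _ => 1 := by
    have e : ∀ y, Real.exp (ψ y / ε) * ∫ w, gaussKernel ε (w - y) ∂(expMeasure ε μ φ) =
        ∫ x, gibbsDensity ε φ ψ (x, y) ∂μ := fun y => by
      simpa using (slice (fun _ => 1) y).symm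
    simp_rw [e]
    refine Integrable.ae_eq_of_forall_setIntegral_eq _ _ iγ.integral_prod_right
      (integrable_const 1) fun s hs _ => ?_
    have hm : Measurable (s.indicator fun _ : Torus d => (1 : ℝ)) := measurable_const.indicator hs
    have hb : ∀ y, |s.indicator (fun _ : Torus d => (1 : ℝ)) y| ≤ 1 := fun y => by
      by_cases hy : y ∈ s <;> simp [hy]
    have key := h.integral_add_integral_eq hε (measurable_const (a := (0 : ℝ))) hm
      (C := 1) (by simp) hb
    simp only [integral_zero, zero_add] at key
    have ig : Integrable (fun p => s.indicator (fun _ => (1 : ℝ)) p.2 * gibbsDensity ε φ ψ p)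
        (μ.prod ν) := iγ.bdd_mul (c := 1) (hm.comp measurable_snd).aestronglyMeasurable
      (Filter.Eventually.of_forall fun p => hb p.2)
    rw [integral_prod_symm _ ig] at key
    simp only [integral_const_mul] at key
    rw [← integral_indicator hs, ← integral_indicator hs]
    refine Eq.trans ?_ key.symm
    congr 1; ext y
    by_cases hy : y ∈ s <;> simp [hy]
  obtain ⟨C, hC⟩ := isCompact_univ.exists_bound_of_continuousOn hf.continuousOn
  have C0 : 0 ≤ C := (norm_nonneg _).trans (hC 0 (Set.mem_univ _))
  have key := h.integral_add_integral_eq hε hf.measurable (measurable_const (a := (0 : ℝ)))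
    (C := C) (fun x => hC x (Set.mem_univ x)) (by simpa using C0)
  simp only [integral_zero, add_zero] at key
  have ig : Integrable (fun p => f p.1 * gibbsDensity ε φ ψ p) (μ.prod ν) :=
    iγ.bdd_mul (c := C) (hf.measurable.comp measurable_fst).aestronglyMeasurable
      (Filter.Eventually.of_forall fun p => hC p.1 (Set.mem_univ _))
  rw [integral_prod_symm _ ig] at key
  rw [key]
  refine integral_congr_ae ?_
  filter_upwards [marg] with y hy
  rw [slice f y, eq_div_of_mul_eq (by rintro h0; simp [h0] at hy) hy]
  ring

end Optimality

/-! ### Exchanging the marginals -/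

lemma cost_comm {ε : ℝ} (hε : 0 < ε) (x y : Torus d) : cost ε x y = cost ε y x := by
  rw [cost, cost, ← gaussKernel_neg hε (x - y), neg_sub]

lemma gibbsDensity_swap {ε : ℝ} (hε : 0 < ε) (φ ψ : Torus d → ℝ) (p : Torus d × Torus d) :
    gibbsDensity ε ψ φ p = gibbsDensity ε φ ψ p.swap := by
  rw [gibbsDensity, gibbsDensity, cost_comm hε]
  simp [add_comm]

lemma DualFinite.swap {ε : ℝ} (hε : 0 < ε) {μ ν : Measure (Torus d)} [SFinite μ] [SFinite ν]
    {φ ψ : Torus d → ℝ} (h : DualFinite ε μ ν φ ψ) : DualFinite ε ν μ ψ φ :=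
  ⟨h.integrable_right, h.integrable_left, by
    rw [funext (gibbsDensity_swap hε φ ψ)]; exact h.integrable_gibbs.swap⟩

lemma dualObjective_swap {ε : ℝ} (hε : 0 < ε) (μ ν : Measure (Torus d)) [SFinite μ] [SFinite ν]
    (φ ψ : Torus d → ℝ) : dualObjective ε ν μ ψ φ = dualObjective ε μ ν φ ψ := by
  rw [dualObjective, dualObjective, funext (gibbsDensity_swap hε φ ψ),
    integral_prod_swap (fun p => gibbsDensity ε φ ψ p)]
  ring

lemma IsSchrodingerPotentials.swap {ε : ℝ} (hε : 0 < ε) {μ ν : Measure (Torus d)} [SFinite μ]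
    [SFinite ν] {φ ψ : Torus d → ℝ} (h : IsSchrodingerPotentials ε μ ν φ ψ) :
    IsSchrodingerPotentials ε ν μ ψ φ :=
  ⟨h.finite.swap hε, fun φ' ψ' h' => by
    rw [dualObjective_swap hε μ ν ψ' φ', dualObjective_swap hε μ ν φ ψ]
    exact h.isMax _ _ (h'.swap hε)⟩

lemma schrodingerFunctionalBar_eq (ε : ℝ) (μ ν : Measure (Torus d)) (ψ : Torus d → ℝ) :
    schrodingerFunctionalBar ε μ ν ψ = schrodingerFunctional ε ν μ ψ :=
  add_comm _ _

/-! ### Stability of the Schrödinger functional -/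

lemma sub_le_osc (χ : C(Torus d, ℝ)) (x y : Torus d) : χ x - χ y ≤ osc χ :=
  sub_le_sub (le_ciSup (isCompact_range χ.continuous).bddAbove x)
    (ciInf_le (isCompact_range χ.continuous).bddBelow y)

theorem variance_le_mul_schrodingerFunctional_sub {ε : ℝ} (hε : 0 < ε) {μ : Measure (Torus d)}
    [IsProbabilityMeasure μ] {m M : ℝ} {n : Torus d → ℝ} (hn : IsDensityIn m M n) (hm : 0 < m)
    (hM : 0 < M) {φ ψ : Torus d → ℝ}
    (h : IsSchrodingerPotentials ε μ (densityMeasure n) φ ψ) (χ : C(Torus d, ℝ)) {L : ℝ}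
    (hL : 8 * π ^ 2 * d ≤ L) :
    variance χ μ ≤ (4 * ε + 2 * (M / m) * Real.exp L + 8 * osc χ ^ 2 / (3 * ε)) *
      (schrodingerFunctional ε μ (densityMeasure n) φ
        - schrodingerFunctional ε μ (densityMeasure n) (fun x => φ x + χ x)) := by
  have := hn.isProbabilityMeasure hm
  have := h.isFiniteMeasure_expMeasure hε
  have hφ := h.finite.integrable_left.aemeasurable
  have : NeZero (expMeasure ε μ φ) := neZero_expMeasure hφ
  set ν := densityMeasure n
  set ρ := expMeasure ε μ φ
  set X : Torus d → ℝ := fun x => χ x / ε with hXdef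
  have hX : Continuous X := χ.continuous.div_const ε
  have hχX : ∀ x, χ x = ε * X x := fun x => by rw [hXdef]; field_simp
  have osc0 : 0 ≤ osc χ := by simpa using sub_le_osc χ 0 0
  set s := osc χ / ε with hs
  have hs0 : 0 ≤ s := by positivity
  set B := M / (m * ε) * Real.exp (8 * π ^ 2 * d) with hB
  have core := second_moment_sub_sq_le (ρ := ρ) (ν := ν) hε hX hs0
    (fun w w' => by
      simp only [hXdef, hs, ← sub_div]; gcongr; exact sub_le_osc χ w w')
    (variance_tiltMean_le hn hm hM hε hX)
  have e0 : ∀ y, tiltMoment ε ρ X 0 0 y = ∫ w, gaussKernel ε (w - y) ∂ρ := fun y => by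
    simp [tiltMoment]
  have e1 : ∫ y, tiltMean ε ρ X 0 y ∂ν = ∫ x, X x ∂μ := by
    rw [← h.integral_conditional hε hX]
    congr 1; ext y
    rw [tiltMean, e0]; simp [tiltMoment, ρ]
  have e2 : ∫ y, tiltSecond ε ρ X 0 y ∂ν = ∫ x, X x ^ 2 ∂μ := by
    refine Eq.trans ?_ (h.integral_conditional hε (hX.pow 2))
    congr 1; ext y
    rw [tiltSecond, e0]; simp [tiltMoment, ρ]
  have iχ : Integrable χ μ := integrable_of_continuous χ.continuous
  have hT0 : ∀ y, transform ε μ φ y = -ε * Real.log (tiltMoment ε ρ X 0 0 y) := fun y => by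
    rw [← transform_add_eq hε hφ]; simp
  have hT1 : ∀ y, transform ε μ (fun x => φ x + χ x) y =
      -ε * Real.log (tiltMoment ε ρ X 0 1 y) := fun y => by
    rw [← transform_add_eq hε hφ]; simp [hχX]
  set D := (∫ y, Real.log (tiltMoment ε ρ X 0 1 y) ∂ν)
    - (∫ y, Real.log (tiltMoment ε ρ X 0 0 y) ∂ν) - ∫ y, tiltMean ε ρ X 0 y ∂ν with hD
  -- By `e1`, the linear term `∫ χ dμ` is `ε` times the derivative at `0`, so only the convexity
  -- remainder survives.
  have hΔ : schrodingerFunctional ε μ ν φ - schrodingerFunctional ε μ ν (fun x => φ x + χ x)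
      = ε * D := by
    rw [schrodingerFunctional, schrodingerFunctional, integral_add h.finite.integrable_left iχ,
      funext hT0, funext hT1, integral_const_mul, integral_const_mul, hD, e1]
    simp_rw [hχX]
    rw [integral_const_mul]
    ring
  have hV : variance χ μ = ε ^ 2 * ((∫ x, X x ^ 2 ∂μ) - (∫ x, X x ∂μ) ^ 2) := by
    have hL2 : MemLp χ 2 μ := (memLp_two_iff_integrable_sq
      χ.continuous.aestronglyMeasurable).2 (integrable_of_continuous (χ.continuous.pow 2))
    rw [variance_eq_sub hL2]
    simp only [Pi.pow_apply, hχX, mul_pow, integral_const_mul]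
    ring
  rw [e1, e2] at core
  have hV0 := variance_nonneg χ μ
  have hB0 : 0 ≤ B := by positivity
  have hW0 : 0 ≤ (∫ x, X x ^ 2 ∂μ) - (∫ x, X x ∂μ) ^ 2 :=
    nonneg_of_mul_nonneg_right (hV ▸ hV0) (by positivity)
  rw [← hB] at core
  have hD0 : 0 ≤ D := nonneg_of_mul_nonneg_right (hW0.trans core) (by positivity)
  rw [hΔ, hV]
  -- The linear term in `s` is absorbed by `4s ≤ 2 + 2s² ≤ 2 + (8/3)s²`; this turns `2ε` into `4ε`.
  have hco : ε * (2 * (1 + B) + 4 * s) ≤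
      4 * ε + 2 * (M / m) * Real.exp L + 8 * osc χ ^ 2 / (3 * ε) := by
    have h1 : ε * B = M / m * Real.exp (8 * π ^ 2 * d) := by rw [hB]; field_simp
    have h2 : M / m * Real.exp (8 * π ^ 2 * d) ≤ M / m * Real.exp L := by gcongr
    have h3 : osc χ = ε * s := by rw [hs]; field_simp
    have h4 : 8 * (ε * s) ^ 2 / (3 * ε) = 8 / 3 * ε * s ^ 2 := by field_simp
    rw [h3, h4]
    nlinarith [mul_nonneg hε.le (sq_nonneg (s - 1)), mul_nonneg hε.le (sq_nonneg s)]
  calc ε ^ 2 * ((∫ x, X x ^ 2 ∂μ) - (∫ x, X x ∂μ) ^ 2)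
      ≤ ε ^ 2 * ((2 * (1 + B) + 4 * s) * D) := by
        exact mul_le_mul_of_nonneg_left core (by positivity)
    _ = (ε * (2 * (1 + B) + 4 * s)) * (ε * D) := by ring
    _ ≤ _ := mul_le_mul_of_nonneg_right hco (by positivity)

/-! ### Strong convexity of the squared distance near the origin -/

lemma abs_le_abs_sub_two_pi_mul {w : ℝ} (hw : |w| ≤ π) (j : ℤ) : |w| ≤ |w - 2 * π * j| := by
  rcases eq_or_ne j 0 with rfl | hj
  · simp
  · have h1 : (1 : ℝ) ≤ |(j : ℝ)| := by exact_mod_cast Int.one_le_abs hj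
    have h2 : |2 * π * (j : ℝ)| - |w| ≤ |w - 2 * π * j| := by
      rw [abs_sub_comm]; exact abs_sub_abs_le_abs_sub _ _
    rw [abs_mul, abs_of_pos Real.two_pi_pos] at h2
    nlinarith [Real.pi_pos]

lemma exists_rep_eq {x : Torus d} {u : Fin d → ℝ} (h : toTorus u = x) :
    ∃ a : Fin d → ℤ, ∀ i, rep x i = u i + 2 * π * a i := by
  have : ∀ i, ∃ a : ℤ, rep x i = u i + 2 * π * a := fun i => by
    have h1 : ((u i : ℝ) : AddCircle (2 * π)) = (rep x i : ℝ) := by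
      rw [coe_rep, ← h]; rfl
    obtain ⟨n, hn⟩ := AddSubgroup.mem_zmultiples_iff.1 (QuotientAddGroup.eq.1 h1)
    refine ⟨n, ?_⟩
    rw [zsmul_eq_mul] at hn
    linarith
  exact ⟨fun i => (this i).choose, fun i => (this i).choose_spec⟩

/-- When the lifts differ by at most `π` in every coordinate, the zero shift is optimal coordinate
by coordinate. The integers `a`, `b` account for the difference between these lifts and the
representatives in `[0, 2π)`. -/
lemma torusDist_eq {x y : Torus d} {u v : EuclideanSpace ℝ (Fin d)}
    (hu : toTorus (fun i => u i) = x) (hv : toTorus (fun i => v i) = y)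
    (huv : ∀ i, |u i - v i| ≤ π) : torusDist x y = ‖u - v‖ := by
  obtain ⟨a, ha⟩ := exists_rep_eq hu
  obtain ⟨b, hb⟩ := exists_rep_eq hv
  have bdd : BddBelow (Set.range fun k : Fin d → ℤ =>
      shiftNorm (fun i => rep x i - rep y i) k) :=
    ⟨0, by rintro _ ⟨k, rfl⟩; exact norm_nonneg _⟩
  refine le_antisymm ((ciInf_le bdd (a - b)).trans (le_of_eq ?_)) (le_ciInf fun k => ?_)
  · rw [shiftNorm]
    congr 1
    ext i
    simp only [ha, hb, Pi.sub_apply, PiLp.sub_apply]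
    push_cast
    ring
  · refine le_of_abs_le (abs_le_of_sq_le_sq ?_ (norm_nonneg _))
    rw [shiftNorm_sq, EuclideanSpace.real_norm_sq_eq]
    refine Finset.sum_le_sum fun i _ => sq_le_sq.2 ?_
    refine (abs_le_abs_sub_two_pi_mul (huv i) (k i - a i + b i)).trans (le_of_eq ?_)
    congr 1
    simp only [ha, hb]
    push_cast
    ring

lemma exists_lift (x : Torus d) : ∃ u : EuclideanSpace ℝ (Fin d),
    toTorus (fun i => u i) = x ∧ (∀ i, |u i| ≤ π) ∧ torusDist 0 x = ‖u‖ := by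
  set u : EuclideanSpace ℝ (Fin d) :=
    WithLp.toLp 2 fun i => (AddCircle.equivIco (2 * π) (-π) (x i) : ℝ) with hu
  have h1 : toTorus (fun i => u i) = x := by
    ext i; exact AddCircle.coe_equivIco
  have h2 : ∀ i, |u i| ≤ π := fun i => by
    have := (AddCircle.equivIco (2 * π) (-π) (x i)).2
    exact abs_le.2 ⟨this.1, by linarith [this.2]⟩
  refine ⟨u, h1, h2, ?_⟩
  rw [torusDist_eq (u := 0) (v := u) (by ext i; simp [toTorus]) h1 (by simpa using h2)]
  simp

/-- Lifts of points in the unit ball differ by less than `2 < π` in each coordinate, so distances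
are Euclidean there. The squared norm satisfies the strong convexity relation with equality for `α =
2`. -/
theorem sqDistStronglyConvex_two_one (d : ℕ) : SqDistStronglyConvex d 2 1 := by
  intro t _ x₀ h₀ x₁ h₁ z hz
  obtain ⟨hz, e₀, e₁⟩ := hz
  obtain ⟨p, hp, -, np⟩ := exists_lift x₀
  obtain ⟨q, hq, -, nq⟩ := exists_lift x₁
  obtain ⟨w, hw, -, nw⟩ := exists_lift z
  have close : ∀ {u v : EuclideanSpace ℝ (Fin d)}, ‖u‖ < 1 → ‖v‖ < 1 →
      ∀ i, |u i - v i| ≤ π := fun {u v} hu hv i => by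
    have a := PiLp.norm_apply_le u i
    have b := PiLp.norm_apply_le v i
    rw [Real.norm_eq_abs] at a b
    have := abs_sub (u i) (v i)
    linarith [Real.pi_gt_three]
  have p1 : ‖p‖ < 1 := np ▸ h₀
  have q1 : ‖q‖ < 1 := nq ▸ h₁
  have w1 : ‖w‖ < 1 := nw ▸ hz
  rw [torusDist_eq hw hp (close w1 p1), torusDist_eq hp hq (close p1 q1)] at e₀
  rw [torusDist_eq hw hq (close w1 q1), torusDist_eq hp hq (close p1 q1)] at e₁
  simp only
  rw [np, nq, nw, torusDist_eq hp hq (close p1 q1)]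
  have i1 : ‖w - ((1 - t) • p + t • q)‖ ^ 2 =
      (1 - t) * ‖w - p‖ ^ 2 + t * ‖w - q‖ ^ 2 - t * (1 - t) * ‖p - q‖ ^ 2 := by
    simp only [norm_sub_sq_real, norm_add_sq_real, inner_add_right, real_inner_smul_left,
      real_inner_smul_right, norm_smul, mul_pow, Real.norm_eq_abs, sq_abs]
    ring
  have i2 : ‖(1 - t) • p + t • q‖ ^ 2 =
      (1 - t) * ‖p‖ ^ 2 + t * ‖q‖ ^ 2 - t * (1 - t) * ‖p - q‖ ^ 2 := by
    simp only [norm_sub_sq_real, norm_add_sq_real, real_inner_smul_left,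
      real_inner_smul_right, norm_smul, mul_pow, Real.norm_eq_abs, sq_abs]
    ring
  -- The two distance conditions force the lift of `z` to be the affine interpolant: the expansion
  -- `i1` collapses since `(1 - t)t² + t(1 - t)² = t(1 - t)`.
  have i3 : ‖w - ((1 - t) • p + t • q)‖ ^ 2 = 0 := by
    rw [i1, e₀, e₁]; ring
  have hwe : w = (1 - t) • p + t • q := sub_eq_zero.1 (norm_eq_zero.1 (pow_eq_zero_iff two_ne_zero |>.1 i3))
  rw [hwe, i2]
  linarith

end SchrodingerStability

end

theorem mainTheorem5 :
    (∃ α R : ℝ, 0 < α ∧ 0 < R ∧ ∀ d : ℕ, SchrodingerStability.SqDistStronglyConvex d α R) ∧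
    ∀ d : ℕ, ∃ C : ℝ → ℝ → ℝ, (∀ m M : ℝ, 0 < m → 0 < M → 0 < C m M) ∧
      ∀ α R : ℝ, 0 < α → 0 < R → SchrodingerStability.SqDistStronglyConvex d α R →
      ∀ mμ Mμ mν Mν : ℝ, 0 < mμ → 0 < Mμ → 0 < mν → 0 < Mν →
      ∀ μ ν : SchrodingerStability.Torus d → ℝ,
        SchrodingerStability.IsDensityIn mμ Mμ μ → SchrodingerStability.IsDensityIn mν Mν ν →
      ∀ ε : ℝ, 0 < ε → ∀ φ ψ : SchrodingerStability.Torus d → ℝ,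
        SchrodingerStability.IsSchrodingerPotentials ε (SchrodingerStability.densityMeasure μ)
          (SchrodingerStability.densityMeasure ν) φ ψ →
      ∀ χ η : C(SchrodingerStability.Torus d, ℝ),
        ProbabilityTheory.variance χ (SchrodingerStability.densityMeasure μ) ≤
          (4 * ε + C mν Mν * Real.exp (2 * R ^ 2 / α + 8 * Real.pi ^ 2 * d)
              + 8 * SchrodingerStability.osc χ ^ 2 / (3 * ε)) *
            (SchrodingerStability.schrodingerFunctional ε (SchrodingerStability.densityMeasure μ)
                (SchrodingerStability.densityMeasure ν) φ
              - SchrodingerStability.schrodingerFunctional ε (SchrodingerStability.densityMeasure μ)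
                (SchrodingerStability.densityMeasure ν) (fun x => φ x + χ x)) ∧
        ProbabilityTheory.variance η (SchrodingerStability.densityMeasure ν) ≤
          (4 * ε + C mμ Mμ * Real.exp (2 * R ^ 2 / α + 8 * Real.pi ^ 2 * d)
              + 8 * SchrodingerStability.osc η ^ 2 / (3 * ε)) *
            (SchrodingerStability.schrodingerFunctionalBar ε
                (SchrodingerStability.densityMeasure μ)
                (SchrodingerStability.densityMeasure ν) ψ
              - SchrodingerStability.schrodingerFunctionalBar ε
                (SchrodingerStability.densityMeasure μ)
                (SchrodingerStability.densityMeasure ν) (fun y => ψ y + η y)) := by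
  -- In `2 * (M / m)`, the ratio is the cost of passing between the density and Lebesgue measure in
  -- the Poincaré-type inequality, and the `2` comes from the double integration in `t`.
  refine ⟨⟨2, 1, two_pos, one_pos, SchrodingerStability.sqDistStronglyConvex_two_one⟩,
    fun d => ⟨fun m M => 2 * (M / m), fun m M hm hM => by positivity, ?_⟩⟩
  intro α R hα _ _ mμ Mμ mν Mν hmμ hMμ hmν hMν μ ν hμ hν ε hε φ ψ h χ η
  have := hμ.isProbabilityMeasure hmμ
  have := hν.isProbabilityMeasure hmν
  have hL : 8 * Real.pi ^ 2 * d ≤ 2 * R ^ 2 / α + 8 * Real.pi ^ 2 * d :=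
    le_add_of_nonneg_left (by positivity)
  refine ⟨SchrodingerStability.variance_le_mul_schrodingerFunctional_sub hε hν hmν hMν h χ hL, ?_⟩
  rw [SchrodingerStability.schrodingerFunctionalBar_eq,
    SchrodingerStability.schrodingerFunctionalBar_eq]
  exact SchrodingerStability.variance_le_mul_schrodingerFunctional_sub hε hμ hmμ hMμ
    (h.swap hε) η hL
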